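/- Let $n \ge 2$ and let $P$ be a set of $2n$ points in the plane in general position (no three on a line). For $0 \le k \le n-1$, a $k$-halving line of $P$ is a line through two points of $P$ that has exactly $n-1-k$ of the remaining $2n-2$ points on one side and exactly $n-1+k$ on the other; a halving line is a $0$-halving line. A caterpillar is a tree that becomes a path (possibly with at most one vertex) when all its vertices of degree $1$ are deleted. A tree $T$ on $2n$ vertices with a $4$-vertex path $u_1u_2u_3u_4$ is called $P_4$-symmetric (with respect to this path) if, for some $i \in \{2,4\}$, deleting the three edges of the path leaves $u_1$ and $u_i$ isolated together with two components $A \ni u_3$ and $B \ni u_{6-i}$ such that some graph isomorphism $\varphi : A \to B$ satisfies $\varphi(u_3) = u_{6-i}$ (for $n = 2$ the components $A$, $B$ are single vertices). Such a $T$ is a $w$-caterpillar if $T$ or $T - u_1$ is a caterpillar. Let $r$ be an integer with $1 \le r \le n-1$. Suppose that some point $w \in P$ lies on $2n-1$ halving lines of $P$, and that every point of $P \setminus \{w\}$ lies on exactly two $k$-halving lines of $P$ for each $k = 1, 2, \ldots, r$. Then the edges of the complete geometric graph on $P$ (all straight-line segments joining two points of $P$) can be partitioned into $n$ plane (non-crossing)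 spanning trees, $n-1$ of which are $w$-caterpillars and are pairwise isomorphic as graphs. -/

import Mathlib

namespace GeomGraph

/-- The Euclidean plane. -/
abbrev Plane : Type := EuclideanSpace ℝ (Fin 2)

/-- No three distinct points of `P` lie on a common line. -/
def GeneralPosition (P : Finset Plane) : Prop :=
  ∀ a ∈ P, ∀ b ∈ P, ∀ c ∈ P, a ≠ b → a ≠ c → b ≠ c → ¬ Collinear ℝ ({a, b, c} : Set Plane)

/-- Twice the signed area of the triangle `u v x`. For `u ≠ v` it is positive exactly on the open
half-plane to the left of the directed line from `u` to `v`, negative exactly on the open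
half-plane to its right, and zero exactly on the line. -/
def orient (u v x : Plane) : ℝ :=
  (v 0 - u 0) * (x 1 - u 1) - (v 1 - u 1) * (x 0 - u 0)

/-- The points of `P` strictly to the left of the directed line from `u` to `v`. -/
def leftPoints (P : Finset Plane) (u v : Plane) : Set Plane :=
  {x | x ∈ P ∧ 0 < orient u v x}

/-- The points of `P` strictly to the right of the directed line from `u` to `v`. -/
def rightPoints (P : Finset Plane) (u v : Plane) : Set Plane :=
  {x | x ∈ P ∧ orient u v x < 0}

/-- `L` is a `k`-halving line of the set `P` of `2 * m` points: it passes through two points of `P`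
and has exactly `m - 1 - k` points of `P` on one side and exactly `m - 1 + k` on the other.
The pair `(u, v)` is ordered, and exchanging `u` and `v` exchanges the two sides, so either side
may be the smaller one. The equations are arranged so as to avoid truncated subtraction. -/
def IsKHalvingLine (P : Finset Plane) (k : ℕ) (L : AffineSubspace ℝ Plane) : Prop :=
  ∃ m : ℕ, P.card = 2 * m ∧ ∃ u ∈ P, ∃ v ∈ P, u ≠ v ∧ L = line[ℝ, u, v] ∧
    (leftPoints P u v).ncard + k + 1 = m ∧ (rightPoints P u v).ncard + 1 = m + k

/-- A halving line leaves the same number of points of `P` on both sides. -/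
def IsHalvingLine (P : Finset Plane) (L : AffineSubspace ℝ Plane) : Prop :=
  IsKHalvingLine P 0 L

/-- The straight-line drawing of `G`, a graph whose vertices are the points of `P`, has no
crossings: two distinct edges meet at most in a common endpoint. -/
def IsPlane {P : Finset Plane} (G : SimpleGraph P) : Prop :=
  ∀ a b c d : P, G.Adj a b → G.Adj c d → s(a, b) ≠ s(c, d) →
    segment ℝ (a : Plane) (b : Plane) ∩ segment ℝ (c : Plane) (d : Plane) ⊆
      ({(a : Plane), (b : Plane)} : Set Plane) ∩ {(c : Plane), (d : Plane)}

/-- The vertices whose degree is not `1`. -/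
def nonLeaves {V : Type*} (G : SimpleGraph V) : Set V :=
  {v | (G.neighborSet v).ncard ≠ 1}

/-- A caterpillar: a tree that becomes a path when all its vertices of degree `1` are deleted. -/
def IsCaterpillar {V : Type*} (G : SimpleGraph V) : Prop :=
  G.IsTree ∧ ∃ m : ℕ, Nonempty (G.induce (nonLeaves G) ≃g SimpleGraph.pathGraph m)

/-- The graph obtained from `T` by deleting the edges of the path `u₁ u₂ u₃ u₄`. -/
def deletePath {V : Type*} (T : SimpleGraph V) (u₁ u₂ u₃ u₄ : V) : SimpleGraph V :=
  T.deleteEdges {s(u₁, u₂), s(u₂, u₃), s(u₃, u₄)}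

/-- There is a graph isomorphism between the component of `x` and the component of `y` in `H`
that maps `x` to `y`. -/
def ComponentsIso {V : Type*} (H : SimpleGraph V) (x y : V) : Prop :=
  ∃ φ : (H.connectedComponentMk x).toSimpleGraph ≃g (H.connectedComponentMk y).toSimpleGraph,
    (φ ⟨x, rfl⟩ : V) = y

/-- `T` is a `P₄`-symmetric tree with respect to its `4`-path `u₁ u₂ u₃ u₄`: after deletion of the
three edges of the path, either `u₁` and `u₄` are isolated and the components of `u₃` and `u₂` are
isomorphic by a map taking `u₃` to `u₂`, or `u₁` and `u₂` are isolated and the components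
of `u₃` and `u₄` are isomorphic by a map taking `u₃` to `u₄`. (Deleting three edges of a tree leaves
exactly four components, so nothing else remains. On `2 * n` vertices the two isomorphic components
have `n - 1` vertices each, so they are nontrivial as soon as `3 ≤ n`, and are single
vertices if `n = 2`.) -/
def IsP4SymmetricAt {V : Type*} (T : SimpleGraph V) (u₁ u₂ u₃ u₄ : V) : Prop :=
  T.IsTree ∧ [u₁, u₂, u₃, u₄].Nodup ∧ T.Adj u₁ u₂ ∧ T.Adj u₂ u₃ ∧ T.Adj u₃ u₄ ∧
    (((deletePath T u₁ u₂ u₃ u₄).neighborSet u₁ = ∅ ∧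
        (deletePath T u₁ u₂ u₃ u₄).neighborSet u₄ = ∅ ∧
        ComponentsIso (deletePath T u₁ u₂ u₃ u₄) u₃ u₂) ∨
      ((deletePath T u₁ u₂ u₃ u₄).neighborSet u₁ = ∅ ∧
        (deletePath T u₁ u₂ u₃ u₄).neighborSet u₂ = ∅ ∧
        ComponentsIso (deletePath T u₁ u₂ u₃ u₄) u₃ u₄))

/-- A `w`-caterpillar: a `P₄`-symmetric tree `T`, with `4`-path `u₁ u₂ u₃ u₄`, such that `T` or
`T - u₁` is a caterpillar. -/
def IsWCaterpillar {V : Type*} (T : SimpleGraph V) : Prop :=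
  ∃ u₁ u₂ u₃ u₄ : V, IsP4SymmetricAt T u₁ u₂ u₃ u₄ ∧
    (IsCaterpillar T ∨ IsCaterpillar (T.induce ({u₁}ᶜ : Set V)))

end GeomGraph

/-!
Only the halving lines and the `1`-halving lines matter. Every line from `w` to another point is
halving, because there are only `2 * n - 1` such lines (`ncard_sides_of_halving_point`). By a lemma of
Lovász, a line that bisects `P` meets exactly `n` halving edges (`sum_card_halving_crossing`). A
bisector close to `w p`, with `w` and `p` on different sides, already meets `n` halving edges at `w`, so
there are no halving lines besides those through `w` (`ncard_sides_ne_of_halving_point`).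

Now rotate the line `p w` about `p` until it meets the next point `q`. Counting both sides shows that
`q` lies on the side of `w` and that `p q` is `1`-halving (`exists_next_halving`). The two senses of
rotation give two such lines, so by hypothesis there are no other `1`-halving lines through `p`. Hence
the relation between `p` and `q` is symmetric, and this yields a map `ψ` on `P \ {w}` for
which every line through `w` and a further point separates `a` from `ψ a`, while the line `a (ψ a)` has
every further point on the same side as the line `a w` (`exists_antipodal_map`).

Orient each edge that avoids `w` from `x` to `y` if `y` is to the left of the line from `w` to `x`, and
fix a point `p₀ ≠ w`. The map `ψ` sends the `n - 1` points on the left of the line `w p₀` bijectively to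
those on its right. For `c` on the left, the outgoing edges of `c`, those of `ψ c`, and the
edge `c w` form a double star. One more double star consists of the outgoing edges of `p₀` and of the
edges from `w` to `p₀` and to the points on the right. These `n` double stars partition all edges, since
each edge is found at its tail (`existsUnique_spokeStar_adj`). They are plane, since the
line through the centres, or the line `w (ψ c)`, separates leaves at different centres. In each of them
both centres have degree `n`; so they are pairwise isomorphic, and exchanging the centres shows the
`P₄`-symmetry (`doubleStar_isWCaterpillar`).
-/

namespace GeomGraph

/-! ### Orientation and the sides of a line -/

theorem orient_swap (u v x : Plane) : orient v u x = -orient u v x := by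
  unfold orient; ring

theorem orient_rotate (u v x : Plane) : orient v x u = orient u v x := by
  unfold orient; ring

@[simp] theorem orient_self_left (u v : Plane) : orient u v u = 0 := by
  unfold orient; ring

@[simp] theorem orient_self_right (u v : Plane) : orient u v v = 0 := by
  unfold orient; ring

theorem plane_ext {u v : Plane} (h0 : u 0 = v 0) (h1 : u 1 = v 1) : u = v := by
  ext i; fin_cases i <;> assumption

theorem collinear_of_orient_eq_zero {u v x : Plane} (huv : u ≠ v) (h : orient u v x = 0) :
    Collinear ℝ ({u, v, x} : Set Plane) := by
  have hpos : (v 0 - u 0) ^ 2 + (v 1 - u 1) ^ 2 ≠ 0 := by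
    intro h0
    apply huv
    apply plane_ext <;> nlinarith [sq_nonneg (v 0 - u 0), sq_nonneg (v 1 - u 1)]
  rw [collinear_iff_of_mem (p₀ := u) (by simp)]
  refine ⟨v - u, ?_⟩
  intro p hp
  simp only [Set.mem_insert_iff, Set.mem_singleton_iff] at hp
  rcases hp with rfl | rfl | rfl
  · exact ⟨0, by simp⟩
  · exact ⟨1, by simp⟩
  · refine ⟨((v 0 - u 0) * (p 0 - u 0) + (v 1 - u 1) * (p 1 - u 1)) /
      ((v 0 - u 0) ^ 2 + (v 1 - u 1) ^ 2), ?_⟩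
    unfold orient at h
    apply plane_ext
    · simp only [vadd_eq_add, PiLp.add_apply, PiLp.smul_apply, PiLp.sub_apply, smul_eq_mul]
      field_simp
      linear_combination (-(v 1 - u 1)) * h
    · simp only [vadd_eq_add, PiLp.add_apply, PiLp.smul_apply, PiLp.sub_apply, smul_eq_mul]
      field_simp
      linear_combination (v 0 - u 0) * h

theorem GeneralPosition.orient_ne_zero {P : Finset Plane} (hP : GeneralPosition P) {u v x : Plane}
    (hu : u ∈ P) (hv : v ∈ P) (hx : x ∈ P) (huv : u ≠ v) (hux : u ≠ x) (hvx : v ≠ x) :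
    orient u v x ≠ 0 := fun h =>
  hP u hu v hv x hx huv hux hvx (collinear_of_orient_eq_zero huv h)

theorem GeneralPosition.eq_or_eq_of_mem_line {P : Finset Plane} (hP : GeneralPosition P)
    {u v x : Plane} (hu : u ∈ P) (hv : v ∈ P) (hx : x ∈ P) (huv : u ≠ v)
    (h : x ∈ line[ℝ, u, v]) : x = u ∨ x = v := by
  by_contra! hne
  refine hP x hx u hu v hv hne.1 hne.2 huv ?_
  exact collinear_insert_of_mem_affineSpan_pair h

theorem leftPoints_swap (P : Finset Plane) (u v : Plane) : leftPoints P v u = rightPoints P u v := by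
  ext x; simp [leftPoints, rightPoints, orient_swap u v x]

theorem rightPoints_swap (P : Finset Plane) (u v : Plane) :
    rightPoints P v u = leftPoints P u v := by
  ext x; simp [leftPoints, rightPoints, orient_swap u v x]

/-- The `k`-halving property of the line through two given points of `P`, read off the two
sides of that line. -/
theorem GeneralPosition.isKHalvingLine_iff {P : Finset Plane} (hP : GeneralPosition P) {n k : ℕ}
    (hcard : P.card = 2 * n) {p q : Plane} (hp : p ∈ P) (hq : q ∈ P) (hpq : p ≠ q) :
    IsKHalvingLine P k line[ℝ, p, q] ↔
      ((leftPoints P p q).ncard + k + 1 = n ∧ (rightPoints P p q).ncard + 1 = n + k) ∨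
      ((rightPoints P p q).ncard + k + 1 = n ∧ (leftPoints P p q).ncard + 1 = n + k) := by
  constructor
  · rintro ⟨m, hm, u, hu, v, hv, huv, hL, h1, h2⟩
    obtain rfl : m = n := by omega
    have hu' := hP.eq_or_eq_of_mem_line hp hq hu hpq (hL ▸ left_mem_affineSpan_pair ℝ u v)
    have hv' := hP.eq_or_eq_of_mem_line hp hq hv hpq (hL ▸ right_mem_affineSpan_pair ℝ u v)
    rcases hu' with rfl | rfl <;> rcases hv' with rfl | rfl
    · exact absurd rfl huv
    · exact Or.inl ⟨h1, h2⟩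
    · rw [leftPoints_swap] at h1
      rw [rightPoints_swap] at h2
      exact Or.inr ⟨h1, h2⟩
    · exact absurd rfl huv
  · rintro (⟨h1, h2⟩ | ⟨h1, h2⟩)
    · exact ⟨n, hcard, p, hp, q, hq, hpq, rfl, h1, h2⟩
    · refine ⟨n, hcard, q, hq, p, hp, hpq.symm, by rw [Set.pair_comm], ?_, ?_⟩
      · rwa [leftPoints_swap]
      · rwa [rightPoints_swap]

theorem IsKHalvingLine.exists_eq_line {P : Finset Plane} (hP : GeneralPosition P) {k : ℕ}
    {L : AffineSubspace ℝ Plane} (hL : IsKHalvingLine P k L) {p : Plane} (hp : p ∈ P)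
    (hpL : p ∈ L) : ∃ q ∈ P, q ≠ p ∧ L = line[ℝ, p, q] := by
  obtain ⟨m, hm, u, hu, v, hv, huv, rfl, -, -⟩ := hL
  rcases hP.eq_or_eq_of_mem_line hu hv hp huv hpL with rfl | rfl
  · exact ⟨v, hv, huv.symm, rfl⟩
  · exact ⟨u, hu, huv, by rw [Set.pair_comm]⟩

theorem GeneralPosition.line_injOn {P : Finset Plane} (hP : GeneralPosition P) {p q q' : Plane}
    (hp : p ∈ P) (hq : q ∈ P) (hq' : q' ∈ P) (hpq : q ≠ p) (hpq' : q' ≠ p)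
    (h : line[ℝ, p, q] = line[ℝ, p, q']) : q = q' := by
  have := hP.eq_or_eq_of_mem_line hp hq' hq hpq'.symm (h ▸ right_mem_affineSpan_pair ℝ p q)
  exact this.resolve_left hpq

/-- If `w` lies on `2 * n - 1` halving lines, then every line joining `w` to another point halves,
since there are only `2 * n - 1` such lines. -/
theorem ncard_sides_of_halving_point {P : Finset Plane} (hP : GeneralPosition P) {n : ℕ}
    (hcard : P.card = 2 * n) {w : Plane} (hw : w ∈ P)
    (hhalv : {L : AffineSubspace ℝ Plane | IsHalvingLine P L ∧ w ∈ L}.ncard = 2 * n - 1)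
    {p : Plane} (hp : p ∈ P) (hpw : p ≠ w) :
    (leftPoints P w p).ncard + 1 = n ∧ (rightPoints P w p).ncard + 1 = n := by
  classical
  set I : Finset (AffineSubspace ℝ Plane) := (P.erase w).image (fun q => line[ℝ, w, q]) with hI
  have hsub : {L : AffineSubspace ℝ Plane | IsHalvingLine P L ∧ w ∈ L} ⊆ (I : Set _) := by
    rintro L ⟨hL, hwL⟩
    obtain ⟨q, hq, hqw, rfl⟩ := IsKHalvingLine.exists_eq_line hP hL hw hwL
    simp only [hI, Finset.coe_image, Set.mem_image, Finset.mem_coe, Finset.mem_erase]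
    exact ⟨q, ⟨hqw, hq⟩, rfl⟩
  have hIc : I.card ≤ 2 * n - 1 := by
    refine Finset.card_image_le.trans ?_
    rw [Finset.card_erase_of_mem hw, hcard]
  have heq := Set.eq_of_subset_of_ncard_le hsub
    (by rw [Set.ncard_coe_finset, hhalv]; exact hIc) (Finset.finite_toSet I)
  have hmem : line[ℝ, w, p] ∈ (I : Set (AffineSubspace ℝ Plane)) := by
    simp only [hI, Finset.coe_image, Set.mem_image, Finset.mem_coe, Finset.mem_erase]
    exact ⟨p, ⟨hpw, hp⟩, rfl⟩
  rw [← heq] at hmem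
  have := (hP.isKHalvingLine_iff hcard hw hp hpw.symm).1 hmem.1
  omega

theorem sum_sign_eq {ι : Type*} (s : Finset ι) (g : ι → ℝ) :
    ∑ x ∈ s, ((SignType.sign (g x) : SignType) : ℤ) =
      ((s.filter fun x => 0 < g x).card : ℤ) - ((s.filter fun x => g x < 0).card : ℤ) := by
  rw [Finset.card_filter, Finset.card_filter]
  push_cast
  rw [← Finset.sum_sub_distrib]
  refine Finset.sum_congr rfl fun x _ => ?_
  rcases lt_trichotomy (g x) 0 with h | h | h
  · simp [h, h.not_gt]
  · simp [h]
  · simp [h, h.not_gt]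

theorem ncard_leftPoints (P : Finset Plane) (u v : Plane) :
    (leftPoints P u v).ncard = (P.filter fun x => 0 < orient u v x).card := by
  rw [← Set.ncard_coe_finset]; congr 1; ext x; simp [leftPoints]

theorem ncard_rightPoints (P : Finset Plane) (u v : Plane) :
    (rightPoints P u v).ncard = (P.filter fun x => orient u v x < 0).card := by
  rw [← Set.ncard_coe_finset]; congr 1; ext x; simp [rightPoints]

theorem sum_sign_orient (P : Finset Plane) (u v : Plane) :
    ∑ x ∈ P, ((SignType.sign (orient u v x) : SignType) : ℤ) =
      ((leftPoints P u v).ncard : ℤ) - ((rightPoints P u v).ncard : ℤ) := by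
  rw [sum_sign_eq, ncard_leftPoints, ncard_rightPoints]

theorem GeneralPosition.ncard_leftPoints_add_ncard_rightPoints {P : Finset Plane}
    (hP : GeneralPosition P) {u v : Plane} (hu : u ∈ P) (hv : v ∈ P) (huv : u ≠ v) :
    (leftPoints P u v).ncard + (rightPoints P u v).ncard + 2 = P.card := by
  classical
  have h1 : (P.filter fun x => 0 < orient u v x) =
      ((P.erase u).erase v).filter fun x => 0 < orient u v x := by
    ext x
    simp only [Finset.mem_filter, Finset.mem_erase]
    refine ⟨fun h => ⟨⟨?_, ?_, h.1⟩, h.2⟩, fun h => ⟨h.1.2.2, h.2⟩⟩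
    · rintro rfl; simp at h
    · rintro rfl; simp at h
  have h2 : (P.filter fun x => orient u v x < 0) =
      ((P.erase u).erase v).filter fun x => ¬ 0 < orient u v x := by
    ext x
    simp only [Finset.mem_filter, Finset.mem_erase]
    refine ⟨fun h => ⟨⟨?_, ?_, h.1⟩, h.2.le.not_gt⟩, fun h => ⟨h.1.2.2, ?_⟩⟩
    · rintro rfl; simp at h
    · rintro rfl; simp at h
    · exact lt_of_le_of_ne (not_lt.1 h.2)
        (hP.orient_ne_zero hu hv h.1.2.2 huv (Ne.symm h.1.2.1) (Ne.symm h.1.1))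
  rw [ncard_leftPoints, ncard_rightPoints, h1, h2, Finset.card_filter_add_card_filter_not,
    Finset.card_erase_of_mem (Finset.mem_erase.2 ⟨huv.symm, hv⟩), Finset.card_erase_of_mem hu]
  have := Finset.one_lt_card.2 ⟨u, hu, v, hv, huv⟩
  omega

/-! ### Halving lines crossing a bisecting line -/

/-- Reading the signs `σ` in increasing order of `t` gives a walk on `ℤ` from `0`; its steps that
cross the level `c / 2` add up to `1`, `0` or `-1`, according to the sides of that level on which
the walk begins and ends. -/
theorem sum_crossings {ι : Type*} [DecidableEq ι] (s : Finset ι) (t : ι → ℝ) (σ : ι → ℤ) (c : ℤ)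
    (hc : Odd c) (ht : Set.InjOn t s) (hσ : ∀ x ∈ s, σ x = 1 ∨ σ x = -1) :
    ∑ q ∈ s, (if 2 * ∑ u ∈ s with t u < t q, σ u + σ q = c then σ q else 0) =
      (if c < 2 * ∑ x ∈ s, σ x then 1 else 0) - (if c < 0 then 1 else 0) := by
  induction s using Finset.induction_on_max_value t with
  | empty => simp
  | insert a s ha hmax ih =>
    have hlt : ∀ x ∈ s, t x < t a := fun x hx => (hmax x hx).lt_of_ne fun h =>
      ha (ht (by simp [hx]) (by simp) h ▸ hx)
    have ih' := ih (ht.mono (by simp)) (fun x hx => hσ x (by simp [hx]))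
    rw [Finset.sum_insert ha, Finset.sum_insert ha]
    have h1 : (insert a s).filter (fun u => t u < t a) = s := by
      ext x
      simp only [Finset.mem_filter, Finset.mem_insert]
      constructor
      · rintro ⟨rfl | h, h'⟩
        · exact absurd h' (lt_irrefl _)
        · exact h
      · exact fun h => ⟨Or.inr h, hlt x h⟩
    have h2 : ∀ q ∈ s, (insert a s).filter (fun u => t u < t q) =
        s.filter (fun u => t u < t q) := fun q hq => by
      rw [Finset.filter_insert, if_neg (hlt q hq).le.not_gt]
    have h3 : ∑ q ∈ s, (if 2 * ∑ u ∈ insert a s with t u < t q, σ u + σ q = c then σ q else 0) =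
        ∑ q ∈ s, (if 2 * ∑ u ∈ s with t u < t q, σ u + σ q = c then σ q else 0) :=
      Finset.sum_congr rfl fun q hq => by rw [h2 q hq]
    rw [h1, h3, ih']
    obtain ⟨d, rfl⟩ := hc
    rcases hσ a (by simp) with h | h <;> rw [h] <;> split_ifs <;> omega

/-- Rotate a line about `p`. Counted with sign, `p` has one more halving line towards the points
with larger value of a linear functional than towards those with smaller value, as long as most
points have larger value. -/
theorem sum_halving_at {P : Finset Plane} (hP : GeneralPosition P) {n : ℕ}
    (hcard : P.card = 2 * n) {p : Plane} (hp : p ∈ P) (a b : ℝ) (f : Plane → ℝ)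
    (hf : ∀ x, f x = a * x 0 + b * x 1) (hinj : ∀ x ∈ P, x ≠ p → f x ≠ f p)
    (hpos : 0 < ∑ x ∈ P.erase p, ((SignType.sign (f x - f p) : SignType) : ℤ)) :
    ∑ q ∈ P.erase p, (if (leftPoints P p q).ncard = (rightPoints P p q).ncard then
      ((SignType.sign (f q - f p) : SignType) : ℤ) else 0) = 1 := by
  classical
  set σ : Plane → ℤ := fun x => ((SignType.sign (f x - f p) : SignType) : ℤ) with hσdef
  set g : Plane → ℝ := fun x => -b * x 0 + a * x 1 with hg
  set t : Plane → ℝ := fun x => (g x - g p) / (f x - f p) with ht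
  have hσ : ∀ x ∈ P.erase p, σ x = 1 ∨ σ x = -1 := by
    intro x hx
    rw [Finset.mem_erase] at hx
    rcases lt_or_gt_of_ne (sub_ne_zero.2 (hinj x hx.2 hx.1)) with h | h
    · right; simp [hσdef, sign_neg h]
    · left; simp [hσdef, sign_pos h]
  have hne : ∀ x ∈ P.erase p, f x - f p ≠ 0 := fun x hx =>
    sub_ne_zero.2 (hinj x (Finset.mem_of_mem_erase hx) (Finset.ne_of_mem_erase hx))
  obtain ⟨x₀, hx₀⟩ : (P.erase p).Nonempty := by
    by_contra h
    rw [Finset.not_nonempty_iff_eq_empty] at h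
    simp [h] at hpos
  have hab : 0 < a ^ 2 + b ^ 2 := by
    by_contra h
    have ha : a = 0 := by nlinarith [sq_nonneg a, sq_nonneg b]
    have hb : b = 0 := by nlinarith [sq_nonneg a, sq_nonneg b]
    exact hne x₀ hx₀ (by simp [hf, ha, hb])
  have hid : ∀ q ∈ P.erase p, ∀ x ∈ P.erase p,
      (a ^ 2 + b ^ 2) * orient p q x = (f q - f p) * (f x - f p) * (t x - t q) := by
    intro q hq x hx
    have h1 := hne q hq
    have h2 := hne x hx
    have e1 : (f x - f p) * t x = g x - g p := by simp only [ht]; field_simp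
    have e2 : (f q - f p) * t q = g q - g p := by simp only [ht]; field_simp
    have : (f q - f p) * (f x - f p) * (t x - t q) =
        (f q - f p) * (g x - g p) - (f x - f p) * (g q - g p) := by
      rw [← e1, ← e2]; ring
    rw [this]
    simp only [hf, hg, orient]; ring
  have htinj : Set.InjOn t (P.erase p) := by
    intro x hx y hy hxy
    by_contra hne'
    have hx' := Finset.mem_erase.1 hx
    have hy' := Finset.mem_erase.1 hy
    have h0 := hid x hx y hy
    rw [hxy, sub_self, mul_zero] at h0
    exact hP.orient_ne_zero hp hx'.2 hy'.2 hx'.1.symm hy'.1.symm hne'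
      ((mul_eq_zero.1 h0).resolve_left hab.ne')
  have hodd : Odd (∑ x ∈ P.erase p, σ x) := by
    have hc : (P.erase p).card + 1 = 2 * n := by rw [Finset.card_erase_add_one hp, hcard]
    have : ∀ s ⊆ P.erase p, (Odd (∑ x ∈ s, σ x) ↔ Odd s.card) := by
      intro s
      induction s using Finset.induction_on with
      | empty => simp
      | insert y s hy ih =>
        intro hs
        have h1 := ih ((Finset.subset_insert _ _).trans hs)
        rw [Finset.sum_insert hy, Finset.card_insert_of_notMem hy]
        have := hσ y (hs (by simp))
        have h2 : Odd (σ y) := by rcases this with h | h <;> rw [h] <;> decide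
        rw [Int.odd_add, Nat.odd_add, ← Int.not_odd_iff_even, h1]
        simp [h2]
    rw [this _ subset_rfl]
    exact ⟨n - 1, by omega⟩
  have hcross := sum_crossings (P.erase p) t σ _ hodd htinj hσ
  rw [if_pos (by linarith), if_neg (by linarith), sub_zero] at hcross
  rw [← hcross]
  refine Finset.sum_congr rfl fun q hq => ?_
  refine if_congr ?_ rfl rfl
  -- `pt` compares the side of `x` with respect to the line `p q` and its place in the walk
  have pt : ∀ x ∈ P.erase p, σ q * ((SignType.sign (orient p q x) : SignType) : ℤ) =
      σ x - 2 * (if t x < t q then σ x else 0) - (if x = q then σ x else 0) := by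
    intro x hx
    have h1 : SignType.sign (orient p q x) =
        SignType.sign (f q - f p) * SignType.sign (f x - f p) * SignType.sign (t x - t q) := by
      rw [← sign_mul, ← sign_mul, ← hid q hq x hx, sign_mul, sign_pos hab, one_mul]
    have h2 : ((SignType.sign (orient p q x) : SignType) : ℤ) =
        σ q * σ x * ((SignType.sign (t x - t q) : SignType) : ℤ) := by
      rw [h1]; push_cast; rfl
    have hqq : σ q * σ q = 1 := by rcases hσ q hq with h | h <;> rw [h] <;> rfl
    rw [h2, show σ q * (σ q * σ x * ((SignType.sign (t x - t q) : SignType) : ℤ)) =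
      (σ q * σ q) * (σ x * ((SignType.sign (t x - t q) : SignType) : ℤ)) by ring, hqq, one_mul]
    by_cases hxq : x = q
    · subst hxq; simp
    · rw [if_neg hxq]
      rcases lt_or_gt_of_ne (fun h => hxq (htinj hx hq h)) with h | h
      · rw [if_pos h, sign_neg (sub_neg.2 h)]; simp; ring
      · rw [if_neg h.le.not_gt, sign_pos (sub_pos.2 h)]; simp
  have hsum := Finset.sum_congr rfl pt
  rw [← Finset.mul_sum, Finset.sum_sub_distrib, Finset.sum_sub_distrib, ← Finset.mul_sum,
    Finset.sum_ite_eq' (P.erase p) q σ, if_pos hq, ← Finset.sum_filter] at hsum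
  have hP' : ∑ x ∈ P.erase p, ((SignType.sign (orient p q x) : SignType) : ℤ) =
      ∑ x ∈ P, ((SignType.sign (orient p q x) : SignType) : ℤ) := by
    rw [← Finset.add_sum_erase P _ hp]; simp
  rw [hP', sum_sign_orient] at hsum
  rcases hσ q hq with h | h <;> rw [h] at hsum ⊢ <;> omega

open Filter Topology in
theorem exists_perturbation {α : Type*} (P : Finset α) (g h : α → ℝ) :
    ∃ ε : ℝ, 0 < ε ∧ ∀ x ∈ P, ∀ y ∈ P, g x < g y → g x + ε * h x < g y + ε * h y := by
  have key : ∀ x ∈ P, ∀ y ∈ P, ∀ᶠ ε : ℝ in 𝓝[>] 0,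
      g x < g y → g x + ε * h x < g y + ε * h y := by
    intro x _ y _
    by_cases hxy : g x < g y
    · have h1 : Tendsto (fun ε : ℝ => g x + ε * h x) (𝓝[>] 0) (𝓝 (g x)) := by
        have : Continuous fun ε : ℝ => g x + ε * h x := by fun_prop
        simpa using (this.tendsto 0).mono_left nhdsWithin_le_nhds
      have h2 : Tendsto (fun ε : ℝ => g y + ε * h y) (𝓝[>] 0) (𝓝 (g y)) := by
        have : Continuous fun ε : ℝ => g y + ε * h y := by fun_prop
        simpa using (this.tendsto 0).mono_left nhdsWithin_le_nhds
      exact (h1.eventually_lt h2 hxy).mono fun _ h _ => h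
    · exact Eventually.of_forall fun _ h => absurd h hxy
  have h1 : ∀ᶠ ε : ℝ in 𝓝[>] 0, ∀ x ∈ P, ∀ y ∈ P,
      g x < g y → g x + ε * h x < g y + ε * h y :=
    (eventually_all_finset P).2 fun x hx => (eventually_all_finset P).2 fun y hy => key x hx y hy
  obtain ⟨ε, h2, h3⟩ := (h1.and self_mem_nhdsWithin).exists
  exact ⟨ε, h3, h2⟩

/-- If a linear functional separates `P` into two halves `L` and `P \ L`, then exactly `n` halving
lines join a point of `L` to a point of `P \ L`. -/
theorem sum_card_halving_crossing {P : Finset Plane} (hP : GeneralPosition P) {n : ℕ}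
    (hcard : P.card = 2 * n) (a b : ℝ) (f : Plane → ℝ) (hf : ∀ x, f x = a * x 0 + b * x 1)
    (hinj : Set.InjOn f P) {L : Finset Plane} (hLP : L ⊆ P) (hL : L.card = n)
    (hsep : ∀ x ∈ L, ∀ y ∈ P \ L, f x < f y) :
    ∑ x ∈ L, ((P \ L).filter fun y =>
      (leftPoints P x y).ncard = (rightPoints P x y).ncard).card = n := by
  classical
  have hR : (P \ L).card = n := by rw [Finset.card_sdiff_of_subset hLP]; omega
  set F : Plane → Plane → ℤ := fun x y =>
    if (leftPoints P x y).ncard = (rightPoints P x y).ncard then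
      ((SignType.sign (f y - f x) : SignType) : ℤ) else 0 with hF
  have hone : ∀ x ∈ L, ∑ y ∈ P, F x y = 1 := by
    intro x hx
    rw [← Finset.add_sum_erase P _ (hLP hx)]
    have h0 : F x x = 0 := by simp [hF]
    rw [h0, zero_add]
    refine sum_halving_at hP hcard (hLP hx) a b f hf
      (fun y hy hyx h => hyx (hinj hy (hLP hx) h)) ?_
    rw [sum_sign_eq]
    have h1 : n ≤ ((P.erase x).filter fun y => 0 < f y - f x).card := by
      rw [← hR]
      refine Finset.card_le_card fun y hy => ?_
      have hlt := hsep x hx y hy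
      simp only [Finset.mem_filter, Finset.mem_erase]
      exact ⟨⟨fun h => by simp [h] at hlt, (Finset.mem_sdiff.1 hy).1⟩, sub_pos.2 hlt⟩
    have h2 : ((P.erase x).filter fun y => f y - f x < 0).card ≤ (L.erase x).card := by
      refine Finset.card_le_card fun y hy => ?_
      simp only [Finset.mem_filter, Finset.mem_erase] at hy ⊢
      refine ⟨hy.1.1, ?_⟩
      by_contra hyL
      have := hsep x hx y (Finset.mem_sdiff.2 ⟨hy.1.2, hyL⟩)
      linarith [hy.2]
    have h3 : (L.erase x).card + 1 = n := by rw [Finset.card_erase_add_one hx, hL]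
    omega
  have hanti : ∀ x y, F y x = -F x y := by
    intro x y
    simp only [hF]
    rw [leftPoints_swap P x y, rightPoints_swap P x y]
    by_cases h : (leftPoints P x y).ncard = (rightPoints P x y).ncard
    · rw [if_pos h, if_pos h.symm, ← neg_sub, Left.sign_neg]
      simp
    · rw [if_neg h, if_neg (fun h' => h h'.symm), neg_zero]
  -- halving lines within `L` are counted once with each sign
  have hLL : ∑ x ∈ L, ∑ y ∈ L, F x y = 0 := by
    have h := Finset.sum_comm (s := L) (t := L) (f := fun x y => F x y)
    have h2 : ∑ y ∈ L, ∑ x ∈ L, F x y = -∑ x ∈ L, ∑ y ∈ L, F x y := by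
      simp_rw [← Finset.sum_neg_distrib]
      exact Finset.sum_congr rfl fun x _ => Finset.sum_congr rfl fun y _ => hanti x y
    omega
  have htot : ∑ x ∈ L, ∑ y ∈ P \ L, F x y = n := by
    have h : ∑ x ∈ L, ∑ y ∈ P, F x y = n := by
      rw [Finset.sum_congr rfl hone]; simp [hL]
    rw [Finset.sum_congr rfl fun x _ =>
      (Finset.sum_sdiff (f := fun y => F x y) hLP).symm, Finset.sum_add_distrib, hLL] at h
    simpa using h
  have : ∀ x ∈ L, ∑ y ∈ P \ L, F x y = (((P \ L).filter fun y =>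
      (leftPoints P x y).ncard = (rightPoints P x y).ncard).card : ℤ) := by
    intro x hx
    rw [Finset.card_filter]
    push_cast
    refine Finset.sum_congr rfl fun y hy => ?_
    simp only [hF]
    rw [sign_pos (sub_pos.2 (hsep x hx y hy))]
    simp
  rw [Finset.sum_congr rfl this] at htot
  exact_mod_cast htot

/-- If all lines joining `w` to other points of `P` are halving lines, then there are no further
halving lines. -/
theorem ncard_sides_ne_of_halving_point {P : Finset Plane} (hP : GeneralPosition P) {n : ℕ}
    (hcard : P.card = 2 * n) {w : Plane} (hw : w ∈ P)
    (hwh : ∀ p ∈ P, p ≠ w → (leftPoints P w p).ncard + 1 = n ∧ (rightPoints P w p).ncard + 1 = n)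
    {p q : Plane} (hp : p ∈ P) (hq : q ∈ P) (hpw : p ≠ w) (hqw : q ≠ w) (hpq : p ≠ q) :
    (leftPoints P p q).ncard ≠ (rightPoints P p q).ncard := by
  classical
  intro hH
  obtain ⟨s, hs, hsq⟩ : ∃ s : ℝ, (s = 1 ∨ s = -1) ∧ s * orient w p q < 0 := by
    rcases lt_or_gt_of_ne (hP.orient_ne_zero hw hp hq hpw.symm hqw.symm hpq) with h | h
    · exact ⟨1, Or.inl rfl, by linarith⟩
    · exact ⟨-1, Or.inr rfl, by linarith⟩
  set g : Plane → ℝ := fun x => s * orient w p x with hg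
  set h : Plane → ℝ := fun x => (p 0 - w 0) * (x 0 - w 0) + (p 1 - w 1) * (x 1 - w 1) with hh
  have hpos : 0 < (p 0 - w 0) ^ 2 + (p 1 - w 1) ^ 2 := by
    by_contra h0
    apply hpw
    apply plane_ext <;> nlinarith [sq_nonneg (p 0 - w 0), sq_nonneg (p 1 - w 1)]
  have hss : s * s = 1 := by rcases hs with rfl | rfl <;> norm_num
  have hgh : ∀ x y, g x = g y → h x = h y → x = y := by
    intro x y h1 h2
    simp only [hg, hh, orient] at h1 h2
    have h1' := congrArg (s * ·) h1
    simp only [← mul_assoc, hss, one_mul] at h1'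
    apply plane_ext
    · refine mul_left_cancel₀ hpos.ne' ?_
      linear_combination (p 0 - w 0) * h2 - (p 1 - w 1) * h1'
    · refine mul_left_cancel₀ hpos.ne' ?_
      linear_combination (p 1 - w 1) * h2 + (p 0 - w 0) * h1'
  -- a line close to `w p` which has `w` and `q` on the same side, and `p` on the other
  obtain ⟨ε, hε, hlt⟩ := exists_perturbation P g h
  set f : Plane → ℝ := fun x => (-s * (p 1 - w 1) + ε * (p 0 - w 0)) * x 0 +
    (s * (p 0 - w 0) + ε * (p 1 - w 1)) * x 1 with hf
  have hfd : ∀ x y, f x - f y = (g x + ε * h x) - (g y + ε * h y) := by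
    intro x y; simp only [hf, hg, hh, orient]; ring
  have hflt : ∀ x ∈ P, ∀ y ∈ P, g x < g y → f x < f y := by
    intro x hx y hy hxy
    linarith [hfd x y, hlt x hx y hy hxy]
  have hinj : Set.InjOn f P := by
    intro x hx y hy hxy
    rcases lt_trichotomy (g x) (g y) with h1 | h1 | h1
    · exact absurd hxy (hflt x hx y hy h1).ne
    · refine hgh x y h1 ?_
      have h2 := hfd x y
      rw [hxy, h1] at h2
      have : ε * h x = ε * h y := by linarith
      exact mul_left_cancel₀ hε.ne' this
    · exact absurd hxy (hflt y hy x hx h1).ne'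
  have hgw : g w = 0 := by simp [hg]
  have hgp : g p = 0 := by simp [hg]
  set L := insert w (P.filter fun x => g x < 0) with hLdef
  have hwL : w ∈ L := by simp [hLdef]
  have hLP : L ⊆ P := by
    intro x hx
    simp only [hLdef, Finset.mem_insert, Finset.mem_filter] at hx
    rcases hx with rfl | hx
    exacts [hw, hx.1]
  have hLcard : L.card = n := by
    rw [hLdef, Finset.card_insert_of_notMem (by simp [hgw])]
    have := hwh p hp hpw
    rw [ncard_leftPoints, ncard_rightPoints] at this
    rcases hs with rfl | rfl
    · simpa [hg] using this.2
    · simpa [hg] using this.1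
  have hpR : p ∈ P \ L := by simp [hLdef, hp, hgp, hpw]
  have hqL : q ∈ L := by simp [hLdef, hq, hg, hsq]
  have hsep : ∀ x ∈ L, ∀ y ∈ P \ L, f x < f y := by
    intro x hx y hy
    have hxP := hLP hx
    simp only [hLdef, Finset.mem_insert, Finset.mem_filter, Finset.mem_sdiff, not_or, not_and,
      not_lt] at hx hy
    have hgy := hy.2.2 hy.1
    rcases hx with rfl | hx
    · by_cases hyp : y = p
      · subst hyp
        have := hfd y x
        rw [hgp, hgw] at this
        have h2 : 0 < ε * (h y - h x) := by
          refine mul_pos hε ?_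
          simp only [hh]; nlinarith
        linarith
      · refine hflt x hw y hy.1 ?_
        rw [hgw]
        refine hgy.lt_of_ne fun h0 => ?_
        refine hP.orient_ne_zero hw hp hy.1 hpw.symm (Ne.symm hy.2.1) (Ne.symm hyp) ?_
        rcases hs with rfl | rfl <;> simpa [hg] using h0.symm
    · exact hflt x hxP y hy.1 (by linarith [hx.2])
  have hcount := sum_card_halving_crossing hP hcard _ _ f (fun x => rfl) hinj hLP hLcard hsep
  have hwc : ((P \ L).filter fun y =>
      (leftPoints P w y).ncard = (rightPoints P w y).ncard).card = n := by
    rw [Finset.filter_true_of_mem]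
    · rw [Finset.card_sdiff_of_subset hLP]; omega
    · intro y hy
      have hyw : y ≠ w := fun h => (Finset.mem_sdiff.1 hy).2 (h ▸ hwL)
      have := hwh y (Finset.mem_sdiff.1 hy).1 hyw
      omega
  have hqc : 0 < ((P \ L).filter fun y =>
      (leftPoints P q y).ncard = (rightPoints P q y).ncard).card := by
    refine Finset.card_pos.2 ⟨p, Finset.mem_filter.2 ⟨hpR, ?_⟩⟩
    rw [leftPoints_swap P p q, rightPoints_swap P p q]; exact hH.symm
  rw [← Finset.add_sum_erase L _ hwL, hwc] at hcount
  have := Finset.single_le_sum (f := fun x => ((P \ L).filter fun y =>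
      (leftPoints P x y).ncard = (rightPoints P x y).ncard).card)
      (fun _ _ => Nat.zero_le _) (Finset.mem_erase.2 ⟨hqw, hqL⟩)
  omega

/-! ### `1`-halving lines and antipodal neighbours -/

/-- The first point `q` met when the line `p w` is rotated about `p`; the parameter `s = ±1` is the
sense of rotation. The line `p q` is not halving, so `q` is met on the side of `w`, which makes
`p q` a `1`-halving line. No further point lies between the two lines: they
have the same points on their left. -/
theorem exists_next_halving {P : Finset Plane} (hP : GeneralPosition P) {n : ℕ} (hn : 2 ≤ n)
    (hcard : P.card = 2 * n) {w : Plane} (hw : w ∈ P)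
    (hwh : ∀ p ∈ P, p ≠ w → (leftPoints P w p).ncard + 1 = n ∧ (rightPoints P w p).ncard + 1 = n)
    {p : Plane} (hp : p ∈ P) (hpw : p ≠ w) {s : ℝ} (hs : s = 1 ∨ s = -1) :
    ∃ q ∈ P, q ≠ p ∧ q ≠ w ∧ 0 < s * orient p w q ∧ IsKHalvingLine P 1 line[ℝ, p, q] ∧
      ∀ x ∈ P, x ≠ p → x ≠ q → x ≠ w → 0 < orient p q x * orient p w x := by
  classical
  set d : Plane → ℝ := fun x => (w 0 - p 0) * (x 0 - p 0) + (w 1 - p 1) * (x 1 - p 1) with hd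
  set c : Plane → ℝ := fun x => orient p w x with hc
  have hpos : 0 < (w 0 - p 0) ^ 2 + (w 1 - p 1) ^ 2 := by
    by_contra h0
    apply hpw
    apply plane_ext <;> nlinarith [sq_nonneg (w 0 - p 0), sq_nonneg (w 1 - p 1)]
  have hne : ((P.erase p).erase w).Nonempty := by
    rw [← Finset.card_pos, Finset.card_erase_of_mem (Finset.mem_erase.2 ⟨hpw.symm, hw⟩),
      Finset.card_erase_of_mem hp]
    omega
  obtain ⟨q, hq, hmax⟩ := Finset.exists_max_image _ (fun x => s * (d x / c x)) hne
  simp only [Finset.mem_erase] at hq hmax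
  obtain ⟨hqw, hqp, hqP⟩ := hq
  have hcne : ∀ x ∈ P, x ≠ p → x ≠ w → c x ≠ 0 := fun x hx hxp hxw =>
    hP.orient_ne_zero hp hw hx hpw hxp.symm hxw.symm
  have hcq := hcne q hqP hqp hqw
  have hsign : ∀ x ∈ P, x ≠ p → x ≠ q → x ≠ w → 0 < s * c q * (orient p q x * c x) := by
    intro x hx hxp hxq hxw
    have hcx := hcne x hx hxp hxw
    have hid : ((w 0 - p 0) ^ 2 + (w 1 - p 1) ^ 2) * orient p q x = d q * c x - c q * d x := by
      simp only [hd, hc, orient]; ring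
    have hid2 : ((w 0 - p 0) ^ 2 + (w 1 - p 1) ^ 2) * (s * c q * (orient p q x * c x)) =
        (c q * c x) ^ 2 * (s * (d q / c q) - s * (d x / c x)) := by
      have : d q * c x - c q * d x = c q * c x * (d q / c q - d x / c x) := by field_simp
      linear_combination (s * c q * c x) * hid + (s * c q * c x) * this
    have h0 : 0 ≤ s * c q * (orient p q x * c x) := by
      refine le_of_mul_le_mul_left ?_ hpos
      rw [hid2, mul_zero]
      exact mul_nonneg (sq_nonneg _) (sub_nonneg.2 (hmax x ⟨hxw, hxp, hx⟩))
    refine h0.lt_of_ne (Ne.symm ?_)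
    have := hP.orient_ne_zero hp hqP hx hqp.symm hxp.symm (Ne.symm hxq)
    rcases hs with rfl | rfl <;> simp [hcq, hcx, this]
  have hbase := hwh p hp hpw
  rw [← leftPoints_swap, ← rightPoints_swap] at hbase
  -- the balance of the two sides of a line through `p` is a sum of signs
  have hsplit : ∀ F : Plane → ℤ, ∑ x ∈ P, F x =
      F p + (F w + (F q + ∑ x ∈ ((P.erase p).erase w).erase q, F x)) := by
    intro F
    rw [Finset.add_sum_erase _ _ (by simp [hqw, hqp, hqP]),
      Finset.add_sum_erase _ _ (by simp [hw, hpw.symm]), Finset.add_sum_erase _ _ hp]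
  have hpw_sum := sum_sign_orient P p w
  have hpq_sum := sum_sign_orient P p q
  rw [hsplit] at hpw_sum hpq_sum
  have hpq' : orient p q w = -orient p w q := by simp only [orient]; ring
  rw [hpq'] at hpq_sum
  simp only [orient_self_left, orient_self_right, sign_zero, SignType.coe_zero, zero_add,
    Left.sign_neg] at hpw_sum hpq_sum
  have hfront : 0 < s * c q := by
    by_contra hneg
    refine ncard_sides_ne_of_halving_point hP hcard hw hwh hp hqP hpw hqw hqp.symm ?_
    have hopp : ∑ x ∈ ((P.erase p).erase w).erase q,
        ((SignType.sign (orient p q x) : SignType) : ℤ) =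
        -∑ x ∈ ((P.erase p).erase w).erase q, ((SignType.sign (orient p w x) : SignType) : ℤ) := by
      rw [← Finset.sum_neg_distrib]
      refine Finset.sum_congr rfl fun x hx => ?_
      simp only [Finset.mem_erase] at hx
      have h0 := hsign x hx.2.2.2 hx.2.2.1 hx.1 hx.2.1
      have h1 : orient p q x * orient p w x < 0 := by
        by_contra h5
        nlinarith [not_lt.1 h5, not_lt.1 hneg]
      rcases mul_neg_iff.1 h1 with h | h <;> simp [sign_pos, sign_neg, h.1, h.2]
    rw [hopp] at hpq_sum
    rcases lt_or_gt_of_ne hcq with h | h <;> simp only [hc] at h <;>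
      simp only [sign_pos, sign_neg, h, SignType.coe_one, SignType.coe_neg]
        at hpw_sum hpq_sum <;> omega
  have hsame : ∀ x ∈ P, x ≠ p → x ≠ q → x ≠ w → 0 < orient p q x * c x :=
    fun x h1 h2 h3 h4 => pos_of_mul_pos_right (hsign x h1 h2 h3 h4) hfront.le
  refine ⟨q, hqP, hqp, hqw, hfront, ?_, hsame⟩
  rw [hP.isKHalvingLine_iff hcard hp hqP hqp.symm]
  have hadd := hP.ncard_leftPoints_add_ncard_rightPoints hp hqP hqp.symm
  have hsum : ∑ x ∈ ((P.erase p).erase w).erase q,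
      ((SignType.sign (orient p q x) : SignType) : ℤ) =
      ∑ x ∈ ((P.erase p).erase w).erase q, ((SignType.sign (orient p w x) : SignType) : ℤ) := by
    refine Finset.sum_congr rfl fun x hx => ?_
    simp only [Finset.mem_erase] at hx
    rcases pos_and_pos_or_neg_and_neg_of_mul_pos (hsame x hx.2.2.2 hx.2.2.1 hx.1 hx.2.1)
      with h | h <;> simp only [hc] at h <;> simp [sign_pos, sign_neg, h.1, h.2]
  rw [hsum] at hpq_sum
  rcases lt_or_gt_of_ne hcq with h | h <;> simp only [hc] at h <;>
    simp only [sign_pos, sign_neg, h, SignType.coe_one, SignType.coe_neg]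
      at hpw_sum hpq_sum <;> omega

/-- On each side of `p w` there is only one point that spans a `1`-halving line with `p`. -/
theorem eq_of_isKHalvingLine_one {P : Finset Plane} (hP : GeneralPosition P) {n : ℕ} (hn : 2 ≤ n)
    (hcard : P.card = 2 * n) {w : Plane} (hw : w ∈ P)
    (hwh : ∀ p ∈ P, p ≠ w → (leftPoints P w p).ncard + 1 = n ∧ (rightPoints P w p).ncard + 1 = n)
    {p : Plane} (hp : p ∈ P) (hpw : p ≠ w)
    (hk : {L : AffineSubspace ℝ Plane | IsKHalvingLine P 1 L ∧ p ∈ L}.ncard = 2)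
    {s : ℝ} (hs : s = 1 ∨ s = -1) {q q' : Plane} (hq : q ∈ P) (hq' : q' ∈ P) (hqp : q ≠ p)
    (hqp' : q' ≠ p) (hqs : 0 < s * orient p w q) (hqs' : 0 < s * orient p w q')
    (hL : IsKHalvingLine P 1 line[ℝ, p, q]) (hL' : IsKHalvingLine P 1 line[ℝ, p, q']) :
    q = q' := by
  obtain ⟨r, hr, hrp, -, hrs, hrL, -⟩ := exists_next_halving hP hn hcard hw hwh hp hpw (s := -s)
    (by rcases hs with rfl | rfl <;> simp)
  obtain ⟨L₁, L₂, -, heq⟩ := Set.ncard_eq_two.1 hk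
  have mem : ∀ x, IsKHalvingLine P 1 line[ℝ, p, x] → line[ℝ, p, x] = L₁ ∨ line[ℝ, p, x] = L₂ := by
    intro x hx
    have : line[ℝ, p, x] ∈ ({L₁, L₂} : Set (AffineSubspace ℝ Plane)) :=
      heq ▸ ⟨hx, left_mem_affineSpan_pair ℝ p x⟩
    simpa using this
  have h1 : line[ℝ, p, q] ≠ line[ℝ, p, r] := fun h => by
    obtain rfl := hP.line_injOn hp hq hr hqp hrp h
    linarith
  have h2 : line[ℝ, p, q'] ≠ line[ℝ, p, r] := fun h => by
    obtain rfl := hP.line_injOn hp hq' hr hqp' hrp h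
    linarith
  apply hP.line_injOn hp hq hq' hqp hqp'
  rcases mem q hL with h | h <;> rcases mem q' hL' with h' | h' <;>
    rcases mem r hrL with h'' | h'' <;> simp_all

/-- The map `ψ` sends a point `a` to the endpoint, on the left of the line from `w` to `a`, of a
`1`-halving line through `a`. Seen from `w`, the points `a` and `ψ a` are neighbours up to a
reflection at `w`: every other line through `w` separates them. Moreover, the line
`a (ψ a)` has the other points on the same sides as the lines `a w` and `w (ψ a)`. -/
theorem exists_antipodal_map {P : Finset Plane} (hP : GeneralPosition P) {n : ℕ} (hn : 2 ≤ n)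
    (hcard : P.card = 2 * n) {w : Plane} (hw : w ∈ P)
    (hwh : ∀ p ∈ P, p ≠ w → (leftPoints P w p).ncard + 1 = n ∧ (rightPoints P w p).ncard + 1 = n)
    (hk : ∀ p ∈ P, p ≠ w →
      {L : AffineSubspace ℝ Plane | IsKHalvingLine P 1 L ∧ p ∈ L}.ncard = 2) :
    ∃ ψ : Plane → Plane,
      (∀ a ∈ P, a ≠ w → ψ a ∈ P ∧ ψ a ≠ a ∧ ψ a ≠ w ∧ 0 < orient w a (ψ a) ∧
        ∀ x ∈ P, x ≠ a → x ≠ ψ a → x ≠ w →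
          orient a (ψ a) x * orient w a x < 0 ∧ 0 < orient a (ψ a) x * orient w (ψ a) x) ∧
      ∀ a ∈ P, ∀ b ∈ P, a ≠ w → b ≠ w → ψ a = ψ b → a = b := by
  have hex : ∀ a ∈ P, a ≠ w → ∃ q ∈ P, q ≠ a ∧ q ≠ w ∧ 0 < orient w a q ∧
      IsKHalvingLine P 1 line[ℝ, a, q] ∧ ∀ x ∈ P, x ≠ a → x ≠ q → x ≠ w →
        orient a q x * orient w a x < 0 ∧ 0 < orient a q x * orient w q x := by
    intro a ha haw
    obtain ⟨q, hq, hqa, hqw, hqs, hqL, hqx⟩ :=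
      exists_next_halving hP hn hcard hw hwh ha haw (s := -1) (Or.inr rfl)
    have hpos : 0 < orient w a q := by rw [orient_swap a w q]; linarith
    have hqL' : IsKHalvingLine P 1 line[ℝ, q, a] := by rwa [Set.pair_comm]
    obtain ⟨r, hr, hrq, hrw, hrs, hrL, hrx⟩ :=
      exists_next_halving hP hn hcard hw hwh hq hqw (s := 1) (Or.inl rfl)
    -- the point `a` is the neighbour of `w` for the rotation about `q` in the other sense
    obtain rfl : r = a := eq_of_isKHalvingLine_one hP hn hcard hw hwh hq hqw (hk q hq hqw)
      (s := 1) (Or.inl rfl) hr ha hrq hqa.symm hrs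
      (by rw [one_mul, orient_rotate, orient_rotate]; exact hpos) hrL hqL'
    refine ⟨q, hq, hqa, hqw, hpos, hqL, fun x hx hxa hxq hxw => ⟨?_, ?_⟩⟩
    · have := hqx x hx hxa hxq hxw
      rw [orient_swap w r x] at this
      linarith
    · have := hrx x hx hxq hxa hxw
      rw [orient_swap r q x, orient_swap w q x] at this
      linarith
  choose! ψ h using hex
  refine ⟨ψ, fun a ha haw => ?_, fun a ha b hb haw hbw hab => ?_⟩
  · obtain ⟨h1, h2, h3, h4, -, h5⟩ := h a ha haw
    exact ⟨h1, h2, h3, h4, h5⟩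
  · obtain ⟨a1, a2, a3, a4, a5, -⟩ := h a ha haw
    obtain ⟨b1, b2, b3, b4, b5, -⟩ := h b hb hbw
    rw [← hab] at b2 b4 b5
    refine eq_of_isKHalvingLine_one hP hn hcard hw hwh a1 a3 (hk _ a1 a3) (s := 1) (Or.inl rfl)
      ha hb a2.symm b2.symm ?_ ?_ (by rwa [Set.pair_comm]) (by rwa [Set.pair_comm])
    · rw [one_mul, orient_rotate, orient_rotate]; exact a4
    · rw [one_mul, orient_rotate, orient_rotate]; exact b4

/-! ### Double stars -/

section DoubleStar

/-- The double star with centres `c` and `d`, where `S` is the set of neighbours of `c`, and its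
complement that of `d`. This is meant for `d ∈ S` and `c ∉ S`, when `c` and `d` are adjacent and all
other vertices are leaves. -/
def doubleStar {V : Type*} (c d : V) (S : Set V) : SimpleGraph V :=
  SimpleGraph.fromRel fun x y => (x = c ∧ y ∈ S) ∨ (x = d ∧ y ∉ S)

variable {V : Type*} {c d : V} {S : Set V}

theorem doubleStar_adj (hd : d ∈ S) (hc : c ∉ S) {x y : V} :
    (doubleStar c d S).Adj x y ↔
      (x = c ∧ y ∈ S) ∨ (x = d ∧ y ∉ S) ∨ (y = c ∧ x ∈ S) ∨ (y = d ∧ x ∉ S) := by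
  simp only [doubleStar, SimpleGraph.fromRel_adj]
  constructor
  · tauto
  · rintro (⟨rfl, h⟩ | ⟨rfl, h⟩ | ⟨rfl, h⟩ | ⟨rfl, h⟩)
    · exact ⟨fun h' => hc (h' ▸ h), by tauto⟩
    · exact ⟨fun h' => h (h' ▸ hd), by tauto⟩
    · exact ⟨fun h' => hc (h' ▸ h), by tauto⟩
    · exact ⟨fun h' => h (h' ▸ hd), by tauto⟩

theorem doubleStar_isTree [Finite V] (hd : d ∈ S) (hc : c ∉ S) : (doubleStar c d S).IsTree := by
  classical
  have hcd : (doubleStar c d S).Adj c d := (doubleStar_adj hd hc).2 (by tauto)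
  have hcon : (doubleStar c d S).Connected := by
    rw [SimpleGraph.connected_iff_exists_forall_reachable]
    refine ⟨c, fun x => ?_⟩
    by_cases hx : x ∈ S
    · exact ((doubleStar_adj hd hc).2 (by tauto)).reachable
    · exact hcd.reachable.trans ((doubleStar_adj hd hc).2 (by tauto)).reachable
  rw [SimpleGraph.isTree_iff_connected_and_card]
  refine ⟨hcon, le_antisymm ?_ hcon.card_vert_le_card_edgeSet_add_one⟩
  -- every vertex other than `c` spans one edge with its parent
  set par : V → V := fun x => if x ∈ S then c else d with hpar
  have hsub : (doubleStar c d S).edgeSet ⊆ (fun x => s(x, par x)) '' ({c}ᶜ : Set V) := by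
    intro e
    induction e using Sym2.ind with
    | _ x y =>
    intro he
    rw [SimpleGraph.mem_edgeSet, doubleStar_adj hd hc] at he
    have hdc : d ≠ c := fun h => hc (h ▸ hd)
    rcases he with ⟨rfl, h⟩ | ⟨rfl, h⟩ | ⟨rfl, h⟩ | ⟨rfl, h⟩
    · exact ⟨y, fun h' => hc (h' ▸ h), by simp [hpar, h, Sym2.eq_swap]⟩
    · by_cases hyc : y = c
      · subst hyc
        exact ⟨x, hdc, by simp [hpar, hd]⟩
      · exact ⟨y, hyc, by simp [hpar, h, Sym2.eq_swap]⟩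
    · exact ⟨x, fun h' => hc (h' ▸ h), by simp [hpar, h]⟩
    · by_cases hyc : x = c
      · subst hyc
        exact ⟨y, hdc, by simp [hpar, hd, Sym2.eq_swap]⟩
      · exact ⟨x, hyc, by simp [hpar, h]⟩
  have h1 := (Set.ncard_le_ncard hsub (Set.toFinite _)).trans (Set.ncard_image_le (Set.toFinite _))
  have h2 := Set.ncard_add_ncard_compl ({c} : Set V)
  rw [Set.ncard_singleton] at h2
  rw [Nat.card_coe_set_eq]
  omega

theorem doubleStar_neighborSet_left (hd : d ∈ S) (hc : c ∉ S) :
    (doubleStar c d S).neighborSet c = S := by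
  ext x
  simp only [SimpleGraph.mem_neighborSet, doubleStar_adj hd hc]
  have hdc : c ≠ d := fun h => hc (h ▸ hd)
  constructor
  · rintro (h | h | h | ⟨rfl, h⟩)
    · exact h.2
    · exact absurd h.1 hdc
    · exact absurd h.2 hc
    · exact hd
  · intro h; exact Or.inl ⟨trivial, h⟩

theorem doubleStar_neighborSet_right (hd : d ∈ S) (hc : c ∉ S) :
    (doubleStar c d S).neighborSet d = Sᶜ := by
  ext x
  simp only [SimpleGraph.mem_neighborSet, doubleStar_adj hd hc, Set.mem_compl_iff]
  have hdc : c ≠ d := fun h => hc (h ▸ hd)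
  constructor
  · rintro (h | h | ⟨rfl, h⟩ | h)
    · exact absurd h.1 hdc.symm
    · exact h.2
    · exact hc
    · exact absurd hd h.2
  · intro h; exact Or.inr (Or.inl ⟨trivial, h⟩)

theorem doubleStar_neighborSet_leaf_left (hd : d ∈ S) (hc : c ∉ S) {x : V} (hx : x ∈ S)
    (hxd : x ≠ d) : (doubleStar c d S).neighborSet x = {c} := by
  ext y
  simp only [SimpleGraph.mem_neighborSet, doubleStar_adj hd hc, Set.mem_singleton_iff]
  have hxc : x ≠ c := fun h => hc (h ▸ hx)
  tauto

theorem doubleStar_neighborSet_leaf_right (hd : d ∈ S) (hc : c ∉ S) {x : V} (hx : x ∉ S)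
    (hxc : x ≠ c) : (doubleStar c d S).neighborSet x = {d} := by
  ext y
  simp only [SimpleGraph.mem_neighborSet, doubleStar_adj hd hc, Set.mem_singleton_iff]
  have hxd : x ≠ d := fun h => hx (h ▸ hd)
  tauto

theorem doubleStar_nonLeaves (hd : d ∈ S) (hc : c ∉ S) (hS : S.ncard ≠ 1) (hS' : Sᶜ.ncard ≠ 1) :
    nonLeaves (doubleStar c d S) = {c, d} := by
  ext x
  simp only [nonLeaves, Set.mem_ofPred_eq, Set.mem_insert_iff, Set.mem_singleton_iff]
  constructor
  · intro h
    by_contra! hx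
    apply h
    by_cases hxS : x ∈ S
    · rw [doubleStar_neighborSet_leaf_left hd hc hxS hx.2, Set.ncard_singleton]
    · rw [doubleStar_neighborSet_leaf_right hd hc hxS hx.1, Set.ncard_singleton]
  · rintro (rfl | rfl)
    · rwa [doubleStar_neighborSet_left hd hc]
    · rwa [doubleStar_neighborSet_right hd hc]

theorem doubleStar_isCaterpillar [Finite V] (hd : d ∈ S) (hc : c ∉ S) (hS : S.ncard ≠ 1)
    (hS' : Sᶜ.ncard ≠ 1) : IsCaterpillar (doubleStar c d S) := by
  refine ⟨doubleStar_isTree hd hc, 2, ?_⟩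
  rw [doubleStar_nonLeaves hd hc hS hS', SimpleGraph.pathGraph_two_eq_top]
  have hcd : (doubleStar c d S).Adj c d := (doubleStar_adj hd hc).2 (by tauto)
  have htop : (doubleStar c d S).induce ({c, d} : Set V) = ⊤ := by
    ext ⟨x, hx⟩ ⟨y, hy⟩
    simp only [SimpleGraph.comap_adj, Function.Embedding.subtype_apply, SimpleGraph.top_adj, ne_eq,
      Subtype.mk.injEq]
    rcases hx with rfl | rfl <;> rcases hy with rfl | rfl <;>
      simp [hcd, hcd.symm, hcd.ne, hcd.ne.symm]
  rw [htop]
  have hcard : Nat.card ({c, d} : Set V) = 2 := by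
    rw [Nat.card_coe_set_eq, Set.ncard_pair hcd.ne]
  have : Finite ({c, d} : Set V) := Set.toFinite _
  exact ⟨SimpleGraph.Iso.completeGraph (Finite.equivFinOfCardEq hcard)⟩

/-- A bijection between two sets of the same size can be chosen with one prescribed value. -/
theorem exists_equiv_apply_eq {α β : Type*} [Finite α] [Finite β] (h : Nat.card α = Nat.card β)
    (a : α) (b : β) : ∃ e : α ≃ β, e a = b := by
  classical
  have e₀ : α ≃ β := Nonempty.some (Finite.card_eq.1 h)
  exact ⟨e₀.trans (Equiv.swap (e₀ a) b), by simp⟩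

theorem doubleStar_iso [Finite V] {c' d' : V} {S' : Set V} (hd : d ∈ S) (hc : c ∉ S)
    (hd' : d' ∈ S') (hc' : c' ∉ S') (hcard : S.ncard = S'.ncard) (hcard' : Sᶜ.ncard = S'ᶜ.ncard) :
    Nonempty (doubleStar c d S ≃g doubleStar c' d' S') := by
  classical
  obtain ⟨e, he⟩ := exists_equiv_apply_eq (α := S) (β := S')
    (by rwa [Nat.card_coe_set_eq, Nat.card_coe_set_eq]) ⟨d, hd⟩ ⟨d', hd'⟩
  obtain ⟨g, hg⟩ := exists_equiv_apply_eq (α := (Sᶜ : Set V)) (β := (S'ᶜ : Set V))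
    (by rwa [Nat.card_coe_set_eq, Nat.card_coe_set_eq]) ⟨c, hc⟩ ⟨c', hc'⟩
  set E : V ≃ V := (Equiv.Set.sumCompl S).symm.trans
    ((Equiv.sumCongr e g).trans (Equiv.Set.sumCompl S')) with hE
  have hES : ∀ (x : V) (hx : x ∈ S), E x = e ⟨x, hx⟩ := fun x hx => by
    simp [hE, Equiv.Set.sumCompl_symm_apply_of_mem hx]
  have hES' : ∀ (x : V) (hx : x ∉ S), E x = g ⟨x, hx⟩ := fun x hx => by
    simp [hE, Equiv.Set.sumCompl_symm_apply_of_notMem hx]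
  have hmem : ∀ x, E x ∈ S' ↔ x ∈ S := by
    intro x
    by_cases hx : x ∈ S
    · simp only [hES x hx, hx, iff_true]; exact (e ⟨x, hx⟩).2
    · simp only [hES' x hx, hx, iff_false]; exact (g ⟨x, hx⟩).2
  have hEc : E c = c' := by rw [hES' c hc, hg]
  have hEd : E d = d' := by rw [hES d hd, he]
  have hxc : ∀ x, E x = c' ↔ x = c := fun x => by rw [← hEc, E.injective.eq_iff]
  have hxd : ∀ x, E x = d' ↔ x = d := fun x => by rw [← hEd, E.injective.eq_iff]
  exact ⟨⟨E, by intro x y; simp only [doubleStar_adj hd hc, doubleStar_adj hd' hc', hmem, hxc, hxd]⟩⟩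

/-- A graph automorphism that maps `x` to `y` identifies their components. -/
theorem componentsIso_of_iso {H : SimpleGraph V} (E : H ≃g H) {x y : V} (hxy : E x = y) :
    ComponentsIso H x y := by
  have key : ∀ v, v ∈ (H.connectedComponentMk x).supp ↔ E v ∈ (H.connectedComponentMk y).supp := by
    intro v
    simp only [SimpleGraph.ConnectedComponent.mem_supp_iff, SimpleGraph.ConnectedComponent.eq]
    rw [← hxy, E.reachable_iff]
  exact ⟨⟨E.toEquiv.subtypeEquiv key, by
    rintro ⟨u, hu⟩ ⟨v, hv⟩; exact E.map_adj_iff⟩, hxy⟩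

/-- A double star whose centres have the same degree, at least `2`, is `P₄`-symmetric: the path goes
through both centres, from a leaf at `c` to a leaf at `d`, and exchanging the two ends of the
double star exchanges the components of the centres. -/
theorem doubleStar_isWCaterpillar [Finite V] (hd : d ∈ S) (hc : c ∉ S) (hcard : S.ncard = Sᶜ.ncard)
    (h2 : 2 ≤ S.ncard) : IsWCaterpillar (doubleStar c d S) := by
  classical
  obtain ⟨a, ha, had⟩ := Set.exists_ne_of_one_lt_ncard (s := S) (by omega) d
  obtain ⟨b, hb, hbc⟩ := Set.exists_ne_of_one_lt_ncard (s := Sᶜ) (by omega) c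
  have hb' : b ∉ S := hb
  have hne : a ≠ c ∧ a ≠ b ∧ c ≠ d ∧ c ≠ b ∧ d ≠ b := by
    refine ⟨?_, ?_, ?_, hbc.symm, ?_⟩ <;> rintro rfl <;> contradiction
  obtain ⟨hac, hab, hcd, hcb, hdb⟩ := hne
  set T := doubleStar c d S with hT
  have hTadj : ∀ x y, T.Adj x y ↔
      (x = c ∧ y ∈ S) ∨ (x = d ∧ y ∉ S) ∨ (y = c ∧ x ∈ S) ∨ (y = d ∧ x ∉ S) :=
    fun x y => doubleStar_adj hd hc
  -- an involution that exchanges `S` with its complement, `c` with `d`, and `a` with `b`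
  obtain ⟨E, hEE, hES, hEd, hEa⟩ : ∃ E : V ≃ V, (∀ x, E (E x) = x) ∧ (∀ x, E x ∈ S ↔ x ∉ S) ∧
      E d = c ∧ E a = b := by
    obtain ⟨e₀, he₀⟩ := exists_equiv_apply_eq (α := S) (β := (Sᶜ : Set V))
      (by rwa [Nat.card_coe_set_eq, Nat.card_coe_set_eq]) ⟨d, hd⟩ ⟨c, hc⟩
    set e := e₀.trans (Equiv.swap (e₀ ⟨a, ha⟩) ⟨b, hb⟩) with he
    have hed : e ⟨d, hd⟩ = ⟨c, hc⟩ := by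
      rw [he, Equiv.trans_apply, he₀, Equiv.swap_apply_of_ne_of_ne]
      · rw [← he₀]; intro h
        exact had (congrArg Subtype.val (e₀.injective h)).symm
      · simpa using hcb
    have hea : e ⟨a, ha⟩ = ⟨b, hb⟩ := by simp [he]
    set E : V ≃ V := (Equiv.Set.sumCompl S).symm.trans
      ((Equiv.sumCongr e e.symm).trans ((Equiv.sumComm _ _).trans (Equiv.Set.sumCompl S))) with hE
    have h1 : ∀ (x : V) (hx : x ∈ S), E x = e ⟨x, hx⟩ := fun x hx => by
      simp [hE, Equiv.Set.sumCompl_symm_apply_of_mem hx]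
    have h2 : ∀ (x : V) (hx : x ∉ S), E x = e.symm ⟨x, hx⟩ := fun x hx => by
      simp [hE, Equiv.Set.sumCompl_symm_apply_of_notMem hx]
    refine ⟨E, fun x => ?_, fun x => ?_, by rw [h1 d hd, hed], by rw [h1 a ha, hea]⟩
    · by_cases hx : x ∈ S
      · rw [h1 x hx, h2 _ (e ⟨x, hx⟩).2]; simp
      · rw [h2 x hx, h1 _ (e.symm ⟨x, hx⟩).2]; simp
    · by_cases hx : x ∈ S
      · simp only [h1 x hx, hx, not_true_eq_false, iff_false]; exact (e ⟨x, hx⟩).2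
      · simp only [h2 x hx, hx, not_false_eq_true, iff_true]; exact (e.symm ⟨x, hx⟩).2
  have hEeq : ∀ x y, E x = y ↔ x = E y := fun x y =>
    ⟨fun h => by rw [← h, hEE], fun h => by rw [h, hEE]⟩
  have hEc : E c = d := by rw [hEeq, hEd]
  have hEb : E b = a := by rw [hEeq, hEa]
  set H := deletePath T a c d b with hH
  have hHadj : ∀ x y, H.Adj x y ↔
      (x = c ∧ y ∈ S ∧ y ≠ a ∧ y ≠ d) ∨ (x = d ∧ y ∉ S ∧ y ≠ b ∧ y ≠ c) ∨
      (y = c ∧ x ∈ S ∧ x ≠ a ∧ x ≠ d) ∨ (y = d ∧ x ∉ S ∧ x ≠ b ∧ x ≠ c) := by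
    intro x y
    simp only [hH, deletePath, SimpleGraph.deleteEdges_adj, hTadj, Set.mem_insert_iff,
      Set.mem_singleton_iff, Sym2.eq_iff]
    constructor
    · rintro ⟨⟨rfl, h⟩ | ⟨rfl, h⟩ | ⟨rfl, h⟩ | ⟨rfl, h⟩, h'⟩
      · exact Or.inl ⟨rfl, h, by tauto, by tauto⟩
      · exact Or.inr (Or.inl ⟨rfl, h, by tauto, by tauto⟩)
      · exact Or.inr (Or.inr (Or.inl ⟨rfl, h, by tauto, by tauto⟩))
      · exact Or.inr (Or.inr (Or.inr ⟨rfl, h, by tauto, by tauto⟩))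
    · rintro (⟨rfl, h, h1, h2⟩ | ⟨rfl, h, h1, h2⟩ | ⟨rfl, h, h1, h2⟩ | ⟨rfl, h, h1, h2⟩)
      · exact ⟨Or.inl ⟨rfl, h⟩, by simp [*, Ne.symm]⟩
      · exact ⟨Or.inr (Or.inl ⟨rfl, h⟩), by simp [*, Ne.symm]⟩
      · exact ⟨Or.inr (Or.inr (Or.inl ⟨rfl, h⟩)), by simp [*, Ne.symm]⟩
      · exact ⟨Or.inr (Or.inr (Or.inr ⟨rfl, h⟩)), by simp [*, Ne.symm]⟩
  have hiso : ∀ x y, H.Adj (E x) (E y) ↔ H.Adj x y := by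
    intro x y
    simp only [hHadj, hES, hEeq, hEc, hEd, hEa, hEb, ne_eq, not_not]
    constructor <;> (rintro (h | h | h | h) <;> simp [h])
  refine ⟨a, c, d, b, ⟨doubleStar_isTree hd hc, ?_, ?_, ?_, ?_, Or.inl ⟨?_, ?_, ?_⟩⟩, Or.inl ?_⟩
  · simp [hac, had, hab, hcd, hcb, hdb]
  · rw [hTadj]; tauto
  · rw [hTadj]; tauto
  · rw [hTadj]; tauto
  · rw [Set.eq_empty_iff_forall_notMem]
    intro y hy
    rw [SimpleGraph.mem_neighborSet, hHadj] at hy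
    rcases hy with h | h | h | h <;> simp_all
  · rw [Set.eq_empty_iff_forall_notMem]
    intro y hy
    rw [SimpleGraph.mem_neighborSet, hHadj] at hy
    rcases hy with h | h | h | h <;> simp_all
  · exact componentsIso_of_iso ⟨E, fun {x y} => hiso x y⟩ hEd
  · exact doubleStar_isCaterpillar hd hc (by omega) (by omega)

end DoubleStar

/-! ### Planarity of double stars -/

theorem orient_swap_right (u v x : Plane) : orient u x v = -orient u v x := by
  unfold orient; ring

theorem exists_orient_eq_of_mem_segment {u v x z : Plane} (hz : z ∈ segment ℝ u x) :
    ∃ t : ℝ, 0 ≤ t ∧ orient u v z = t * orient u v x ∧ (t = 0 → z = u) := by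
  obtain ⟨s, t, hs, ht, hst, rfl⟩ := hz
  obtain rfl : s = 1 - t := by linarith
  refine ⟨t, ht, ?_, ?_⟩
  · simp only [orient, PiLp.add_apply, PiLp.smul_apply, smul_eq_mul]; ring
  · rintro rfl; simp

/-- Two segments that leave a line from different points to different sides are disjoint. -/
theorem disjoint_segment_of_orient {u v x y : Plane} (huv : u ≠ v) (hx : orient u v x < 0)
    (hy : 0 < orient u v y) : Disjoint (segment ℝ u x) (segment ℝ v y) := by
  rw [Set.disjoint_left]
  intro z hzx hzy
  obtain ⟨s, hs, hs1, hs2⟩ := exists_orient_eq_of_mem_segment (v := v) hzx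
  obtain ⟨t, ht, ht1, ht2⟩ := exists_orient_eq_of_mem_segment (v := u) hzy
  rw [orient_swap u v z, orient_swap u v y] at ht1
  have h1 : s = 0 := by nlinarith [mul_nonneg ht hy.le]
  have h2 : t = 0 := by nlinarith [mul_nonneg hs (neg_nonneg.2 hx.le)]
  exact huv ((hs2 h1).symm.trans (ht2 h2))

theorem GeneralPosition.segment_inter_subset {P : Finset Plane} (hP : GeneralPosition P)
    {u x y : Plane} (hu : u ∈ P) (hx : x ∈ P) (hy : y ∈ P) (hux : u ≠ x) (huy : u ≠ y)
    (hxy : x ≠ y) : segment ℝ u x ∩ segment ℝ u y ⊆ {u} := by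
  rintro z ⟨hzx, hzy⟩
  obtain ⟨s, -, hs1, -⟩ := exists_orient_eq_of_mem_segment (v := x) hzx
  obtain ⟨t, -, ht1, ht2⟩ := exists_orient_eq_of_mem_segment (v := x) hzy
  rw [hs1, orient_self_right, mul_zero] at ht1
  exact ht2 ((mul_eq_zero.1 ht1.symm).resolve_right (hP.orient_ne_zero hu hx hy hux huy hxy))

/-- Edges at a common centre do not cross, so planarity of a double star only concerns
leaves at different centres. -/
theorem doubleStar_isPlane {P : Finset Plane} (hP : GeneralPosition P) {c d : P} {S : Set P}
    (hd : d ∈ S) (hc : c ∉ S)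
    (h : ∀ x ∈ S, x ≠ d → ∀ y ∉ S, y ≠ c →
      Disjoint (segment ℝ (c : Plane) x) (segment ℝ (d : Plane) y)) :
    IsPlane (doubleStar c d S) := by
  have hshare : ∀ u x y : P, u ≠ x → u ≠ y → x ≠ y →
      segment ℝ (u : Plane) x ∩ segment ℝ (u : Plane) y ⊆
        ({(u : Plane), (x : Plane)} : Set Plane) ∩ {(u : Plane), (y : Plane)} := by
    intro u x y h1 h2 h3
    refine (hP.segment_inter_subset u.2 x.2 y.2 (Subtype.coe_ne_coe.2 h1) (Subtype.coe_ne_coe.2 h2)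
      (Subtype.coe_ne_coe.2 h3)).trans ?_
    rintro z rfl
    simp
  have hcx : ∀ x ∈ S, c ≠ x := fun x hx h' => hc (h' ▸ hx)
  have hdy : ∀ y ∉ S, d ≠ y := fun y hy h' => hy (h' ▸ hd)
  have hcd : ∀ x ∈ S, ∀ y ∉ S, s(c, x) ≠ s(d, y) →
      segment ℝ (c : Plane) x ∩ segment ℝ (d : Plane) y ⊆
        ({(c : Plane), (x : Plane)} : Set Plane) ∩ {(d : Plane), (y : Plane)} := by
    intro x hx y hy hne
    by_cases hxd : x = d
    · subst hxd
      have hyc : c ≠ y := fun h' => hne (by rw [h', Sym2.eq_swap])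
      have := hshare x c y (hcx x hx).symm (hdy y hy) hyc
      rwa [segment_symm ℝ (x : Plane) c, Set.pair_comm (x : Plane) c] at this
    by_cases hyc : y = c
    · subst hyc
      have := hshare y x d (hcx x hx) (hcx d hd) hxd
      rwa [segment_symm ℝ (y : Plane) d, Set.pair_comm (y : Plane) d] at this
    rw [(h x hx hxd y hy hyc).inter_eq]
    exact Set.empty_subset _
  have main : ∀ p q r s : P, (p = c ∧ q ∈ S ∨ p = d ∧ q ∉ S) → (r = c ∧ s ∈ S ∨ r = d ∧ s ∉ S) →
      s(p, q) ≠ s(r, s) → segment ℝ (p : Plane) q ∩ segment ℝ (r : Plane) s ⊆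
        ({(p : Plane), (q : Plane)} : Set Plane) ∩ {(r : Plane), (s : Plane)} := by
    rintro p q r s (⟨rfl, hq⟩ | ⟨rfl, hq⟩) (⟨rfl, hs⟩ | ⟨rfl, hs⟩) hne
    · exact hshare r q s (hcx q hq) (hcx s hs) fun h' => hne (by rw [h'])
    · exact hcd q hq s hs hne
    · rw [Set.inter_comm, Set.inter_comm {(p : Plane), (q : Plane)}]
      exact hcd s hs q hq hne.symm
    · exact hshare r q s (hdy q hq) (hdy s hs) fun h' => hne (by rw [h'])
  have horient : ∀ p q, (doubleStar c d S).Adj p q →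
      (p = c ∧ q ∈ S ∨ p = d ∧ q ∉ S) ∨ (q = c ∧ p ∈ S ∨ q = d ∧ p ∉ S) := by
    intro p q hpq
    rw [doubleStar_adj hd hc] at hpq
    tauto
  intro p q r s hpq hrs hne
  rcases horient p q hpq with h1 | h1 <;> rcases horient r s hrs with h2 | h2
  · exact main p q r s h1 h2 hne
  · have := main p q s r h1 h2 (by rwa [Sym2.eq_swap (a := s)])
    rwa [segment_symm ℝ (s : Plane), Set.pair_comm (s : Plane)] at this
  · have := main q p r s h1 h2 (by rwa [Sym2.eq_swap (a := q)])
    rwa [segment_symm ℝ (q : Plane), Set.pair_comm (q : Plane)] at this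
  · have := main q p s r h1 h2 (by rwa [Sym2.eq_swap (a := s), Sym2.eq_swap (a := q)])
    rwa [segment_symm ℝ (s : Plane), Set.pair_comm (s : Plane), segment_symm ℝ (q : Plane),
      Set.pair_comm (q : Plane)] at this

/-! ### Partition of the edges into double stars -/

open Classical in
/-- The double star with centres `c` and `ψ c`, where the centre `c` has its out-neighbours in the
relation `R` as neighbours, and `w` in addition. For the base point `p₀` the
second centre is `w`. -/
noncomputable def spokeStar {V : Type*} (R : V → V → Prop) (ψ : V → V) (w p₀ c : V) :
    SimpleGraph V :=
  doubleStar c (if c = p₀ then w else ψ c) {x | x = w ∨ R c x}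

section SpokeStar

variable {V : Type*} {R : V → V → Prop} {ψ : V → V} {w p₀ : V}

theorem spokeStar_base : spokeStar R ψ w p₀ p₀ = doubleStar p₀ w {x | x = w ∨ R p₀ x} := by
  simp [spokeStar]

theorem spokeStar_of_ne {c : V} (hc : c ≠ p₀) :
    spokeStar R ψ w p₀ c = doubleStar c (ψ c) {x | x = w ∨ R c x} := by
  simp [spokeStar, hc]

/-- Let `R` be a tournament on the vertices other than `w`, and let `ψ` map the
out-neighbours of `p₀` bijectively to its in-neighbours, such that `ψ c` and `c` have
complementary out-neighbourhoods. Then an edge that avoids `w` belongs to the star of its tail, which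
is either the first or the second centre of exactly one of the double stars. -/
theorem existsUnique_spokeStar_adj (hp₀ : p₀ ≠ w)
    (hR : ∀ x y, x ≠ w → y ≠ w → x ≠ y → (R x y ↔ ¬R y x)) (hRirr : ∀ x, ¬R x x)
    (hRw : ∀ x, ¬R x w)
    (hψ : ∀ c, c ≠ w → ψ c ≠ w ∧ R c (ψ c))
    (hψR : ∀ c x, c ≠ w → x ≠ w → x ≠ c → x ≠ ψ c → (R (ψ c) x ↔ ¬R c x))
    (hψA : ∀ c, R p₀ c → ψ c ≠ p₀ ∧ ¬R p₀ (ψ c))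
    (hinj : ∀ c c', c ≠ w → c' ≠ w → ψ c = ψ c' → c = c')
    (hsurj : ∀ b, b ≠ w → b ≠ p₀ → ¬R p₀ b → ∃ c, R p₀ c ∧ ψ c = b) {x y : V} (hxy : x ≠ y) :
    ∃! c, (c = p₀ ∨ R p₀ c) ∧ (spokeStar R ψ w p₀ c).Adj x y := by
  have hne : ∀ c, R p₀ c → c ≠ w ∧ c ≠ p₀ := fun c hc =>
    ⟨fun h => hRw p₀ (h ▸ hc), fun h => hRirr p₀ (by rwa [h] at hc)⟩
  have adj₀ : ∀ x y, (spokeStar R ψ w p₀ p₀).Adj x y ↔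
      (x = p₀ ∧ (y = w ∨ R p₀ y)) ∨ (x = w ∧ ¬(y = w ∨ R p₀ y)) ∨
      (y = p₀ ∧ (x = w ∨ R p₀ x)) ∨ (y = w ∧ ¬(x = w ∨ R p₀ x)) := by
    intro x y
    rw [spokeStar_base, doubleStar_adj]
    · rfl
    · exact Or.inl rfl
    · rintro (h | h)
      exacts [hp₀ h, hRirr p₀ h]
  have adj : ∀ c, R p₀ c → ∀ x y, (spokeStar R ψ w p₀ c).Adj x y ↔
      (x = c ∧ (y = w ∨ R c y)) ∨ (x = ψ c ∧ ¬(y = w ∨ R c y)) ∨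
      (y = c ∧ (x = w ∨ R c x)) ∨ (y = ψ c ∧ ¬(x = w ∨ R c x)) := by
    intro c hc x y
    rw [spokeStar_of_ne (hne c hc).2, doubleStar_adj]
    · rfl
    · exact Or.inr (hψ c (hne c hc).1).2
    · rintro (h | h)
      exacts [(hne c hc).1 h, hRirr c h]
  have edge_w : ∀ y, y ≠ w → ∃! c, (c = p₀ ∨ R p₀ c) ∧ (spokeStar R ψ w p₀ c).Adj w y := by
    intro y hy
    by_cases hyA : R p₀ y
    · refine ⟨y, ⟨Or.inr hyA, (adj y hyA w y).2 (by tauto)⟩, ?_⟩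
      rintro c ⟨rfl | hc, hadj⟩
      · rw [adj₀] at hadj
        rcases hadj with h | h | h | h
        · exact absurd h.1.symm hp₀
        · tauto
        · exact h.1.symm
        · exact absurd h.1 hy
      · rw [adj c hc] at hadj
        rcases hadj with h | h | h | h
        · exact absurd h.1.symm (hne c hc).1
        · exact absurd h.1.symm (hψ c (hne c hc).1).1
        · exact h.1.symm
        · tauto
    · refine ⟨p₀, ⟨Or.inl rfl, (adj₀ w y).2 (by tauto)⟩, ?_⟩
      rintro c ⟨rfl | hc, hadj⟩
      · rfl
      · rw [adj c hc] at hadj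
        rcases hadj with h | h | h | h
        · exact absurd h.1.symm (hne c hc).1
        · exact absurd h.1.symm (hψ c (hne c hc).1).1
        · exact absurd (h.1 ▸ hc) hyA
        · tauto
  have edge_R : ∀ x y, x ≠ w → y ≠ w → x ≠ y → R x y →
      ∃! c, (c = p₀ ∨ R p₀ c) ∧ (spokeStar R ψ w p₀ c).Adj x y := by
    intro x y hx hy hxy hRxy
    have hRyx : ¬R y x := (hR x y hx hy hxy).1 hRxy
    -- the tail `x` is one of the centres
    have htail : ∀ c, (c = p₀ ∨ R p₀ c) → (spokeStar R ψ w p₀ c).Adj x y →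
        x = c ∨ (R p₀ c ∧ x = ψ c) := by
      rintro c (rfl | hc) hadj
      · rw [adj₀] at hadj
        rcases hadj with h | h | ⟨rfl, h⟩ | h
        · exact Or.inl h.1
        · exact absurd h.1 hx
        · tauto
        · exact absurd h.1 hy
      · rw [adj c hc] at hadj
        rcases hadj with h | h | ⟨rfl, h⟩ | ⟨rfl, h⟩
        · exact Or.inl h.1
        · exact Or.inr ⟨hc, h.1⟩
        · tauto
        · by_contra hcon
          push Not at hcon
          exact hRyx ((hψR c x (hne c hc).1 hx hcon.1 hxy).2 (by tauto))
    by_cases hxI : x = p₀ ∨ R p₀ x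
    · refine ⟨x, ⟨hxI, ?_⟩, ?_⟩
      · rcases hxI with rfl | hxA
        · rw [adj₀]; tauto
        · rw [adj x hxA]; tauto
      · rintro c ⟨hc, hadj⟩
        rcases htail c hc hadj with h | ⟨hcA, rfl⟩
        · exact h.symm
        · have := hψA c hcA
          tauto
    · push Not at hxI
      obtain ⟨c, hc, rfl⟩ := hsurj x hx hxI.1 hxI.2
      refine ⟨c, ⟨Or.inr hc, ?_⟩, ?_⟩
      · rw [adj c hc]
        refine Or.inr (Or.inl ⟨rfl, ?_⟩)
        rintro (h | h)
        · exact hy h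
        · by_cases hyc : y = c
          · subst hyc; exact hRirr y h
          · exact (hψR c y (hne c hc).1 hy hyc hxy.symm).1 hRxy h
      · rintro c' ⟨hc', hadj⟩
        rcases htail c' hc' hadj with h | ⟨hcA, h⟩
        · rw [h] at hxI
          tauto
        · exact (hinj c c' (hne c hc).1 (hne c' hcA).1 h).symm
  by_cases hxw : x = w
  · subst hxw; exact edge_w y hxy.symm
  by_cases hyw : y = w
  · subst hyw
    simp_rw [SimpleGraph.adj_comm _ x y]
    exact edge_w x hxy
  by_cases hRxy : R x y
  · exact edge_R x y hxw hyw hxy hRxy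
  · simp_rw [SimpleGraph.adj_comm _ x y]
    exact edge_R y x hyw hxw hxy.symm ((hR y x hyw hxw hxy.symm).2 hRxy)

end SpokeStar

end GeomGraph

open GeomGraph in
theorem theorem4 (n r : ℕ) (hn : 2 ≤ n) (hr₁ : 1 ≤ r) (hr₂ : r ≤ n - 1)
    (P : Finset GeomGraph.Plane) (hcard : P.card = 2 * n)
    (hP : GeomGraph.GeneralPosition P)
    (w : GeomGraph.Plane) (hw : w ∈ P)
    (hhalv : {L : AffineSubspace ℝ GeomGraph.Plane |
      GeomGraph.IsHalvingLine P L ∧ w ∈ L}.ncard = 2 * n - 1)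
    (hk : ∀ p ∈ P, p ≠ w → ∀ k : ℕ, 1 ≤ k → k ≤ r →
      {L : AffineSubspace ℝ GeomGraph.Plane |
        GeomGraph.IsKHalvingLine P k L ∧ p ∈ L}.ncard = 2) :
    ∃ T : Fin n → SimpleGraph P,
      (∀ i, (T i).IsTree ∧ GeomGraph.IsPlane (T i)) ∧
      (∀ e ∈ (⊤ : SimpleGraph P).edgeSet, ∃! i, e ∈ (T i).edgeSet) ∧
      ∃ i₀ : Fin n,
        (∀ i, i ≠ i₀ → GeomGraph.IsWCaterpillar (T i)) ∧
        (∀ i j, i ≠ i₀ → j ≠ i₀ → Nonempty (T i ≃g T j)) := by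
  classical
  have hwh : ∀ p ∈ P, p ≠ w →
      (leftPoints P w p).ncard + 1 = n ∧ (rightPoints P w p).ncard + 1 = n :=
    fun p hp hpw => ncard_sides_of_halving_point hP hcard hw hhalv hp hpw
  obtain ⟨ψ', hψ', hinj'⟩ := exists_antipodal_map hP hn hcard hw hwh
    fun p hp hpw => hk p hp hpw 1 le_rfl hr₁
  -- from here on the points of `P` are the vertices
  set W : P := ⟨w, hw⟩ with hW
  have hneW : ∀ x : P, x ≠ W ↔ (x : Plane) ≠ w := fun x => by simp [hW, Subtype.ext_iff]
  set R : P → P → Prop := fun x y => 0 < orient w x y with hR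
  obtain ⟨ψ, hψval⟩ : ∃ ψ : P → P, ∀ a, a ≠ W → (ψ a : Plane) = ψ' a := by
    refine ⟨fun a => if h : a ≠ W then ⟨ψ' a, (hψ' a a.2 ((hneW a).1 h)).1⟩ else a, fun a h => ?_⟩
    simp [h]
  have hRirr : ∀ x, ¬R x x := fun x => by simp [hR]
  have hRw : ∀ x, ¬R x W := fun x => by simp [hR, hW]
  have hne0 : ∀ x y : P, x ≠ W → y ≠ W → x ≠ y → orient w x y ≠ 0 := fun x y hx hy hxy =>
    hP.orient_ne_zero hw x.2 y.2 (Ne.symm ((hneW x).1 hx)) (Ne.symm ((hneW y).1 hy))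
      (Subtype.coe_ne_coe.2 hxy)
  have hRanti : ∀ x y, x ≠ W → y ≠ W → x ≠ y → (R x y ↔ ¬R y x) := by
    intro x y hx hy hxy
    have := hne0 x y hx hy hxy
    simp only [hR, not_lt, orient_swap_right w x y]
    constructor
    · intro h; linarith
    · intro h; exact lt_of_le_of_ne (by linarith) this.symm
  have hRneg : ∀ x y, x ≠ W → y ≠ W → x ≠ y → ¬R x y → orient w x y < 0 :=
    fun x y hx hy hxy h => lt_of_le_of_ne (not_lt.1 h) (hne0 x y hx hy hxy)
  have hψ : ∀ a, a ≠ W → ψ a ≠ W ∧ R a (ψ a) := by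
    intro a ha
    obtain ⟨-, -, h3, h4, -⟩ := hψ' a a.2 ((hneW a).1 ha)
    rw [hneW, hψval a ha]
    exact ⟨h3, by simpa [hR, hψval a ha] using h4⟩
  have hψx : ∀ a x : P, a ≠ W → x ≠ W → x ≠ a → x ≠ ψ a →
      orient a (ψ a) x * orient w a x < 0 ∧ 0 < orient a (ψ a) x * orient w (ψ a) x := by
    intro a x ha hx hxa hxψ
    obtain ⟨-, -, -, -, h5⟩ := hψ' a a.2 ((hneW a).1 ha)
    rw [hψval a ha]
    refine h5 x x.2 (Subtype.coe_ne_coe.2 hxa) ?_ ((hneW x).1 hx)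
    rw [← hψval a ha]; exact Subtype.coe_ne_coe.2 hxψ
  have hψR : ∀ a x, a ≠ W → x ≠ W → x ≠ a → x ≠ ψ a → (R (ψ a) x ↔ ¬R a x) := by
    intro a x ha hx hxa hxψ
    obtain ⟨h1, h2⟩ := hψx a x ha hx hxa hxψ
    simp only [hR, not_lt]
    rcases pos_and_pos_or_neg_and_neg_of_mul_pos h2 with ⟨h3, h4⟩ | ⟨h3, h4⟩
    · exact ⟨fun _ => (neg_of_mul_neg_right h1 h3.le).le, fun _ => h4⟩
    · have := pos_of_mul_neg_right h1 h3.le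
      exact ⟨fun h => absurd h h4.le.not_gt, fun h => absurd this h.not_gt⟩
  have hinj : ∀ a b, a ≠ W → b ≠ W → ψ a = ψ b → a = b := by
    intro a b ha hb hab
    apply Subtype.ext
    refine hinj' a a.2 b b.2 ((hneW a).1 ha) ((hneW b).1 hb) ?_
    rw [← hψval a ha, ← hψval b hb, hab]
  have hcardP : Fintype.card P = 2 * n := by simp [hcard]
  have hRcard : ∀ c, c ≠ W → (Finset.univ.filter fun x => R c x).card + 1 = n := by
    intro c hc
    rw [← (hwh c c.2 ((hneW c).1 hc)).1, ncard_leftPoints, ← Finset.card_map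
      (Function.Embedding.subtype (· ∈ P))]
    congr 2
    ext x
    simp [hR, and_comm]
  obtain ⟨p₀, hp₀⟩ : ∃ p₀ : P, p₀ ≠ W :=
    Fintype.exists_ne_of_one_lt_card (by omega) W
  have hRne : ∀ c, R p₀ c → c ≠ W ∧ c ≠ p₀ := fun c hc =>
    ⟨fun h => hRw p₀ (h ▸ hc), fun h => hRirr p₀ (by rwa [h] at hc)⟩
  have hψA : ∀ c, R p₀ c → ψ c ≠ p₀ ∧ ¬R p₀ (ψ c) := by
    intro c hc
    obtain ⟨hcW, hcp⟩ := hRne c hc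
    have hcp₀ : ¬R c p₀ := (hRanti p₀ c hp₀ hcW hcp.symm).1 hc
    have h1 : ψ c ≠ p₀ := fun h => hcp₀ (h ▸ (hψ c hcW).2)
    exact ⟨h1, (hRanti (ψ c) p₀ (hψ c hcW).1 hp₀ h1).1
      ((hψR c p₀ hcW hp₀ hcp.symm h1.symm).2 hcp₀)⟩
  -- both sides of the line `w p₀` have `n - 1` points, and `ψ` maps one into the other
  have hsurj : ∀ b, b ≠ W → b ≠ p₀ → ¬R p₀ b → ∃ c, R p₀ c ∧ ψ c = b := by
    set A := Finset.univ.filter fun x => R p₀ x with hA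
    set B := Finset.univ.filter fun x => x ≠ W ∧ x ≠ p₀ ∧ ¬R p₀ x with hB
    have hsub : A.image ψ ⊆ B := by
      intro b hb
      simp only [hA, hB, Finset.mem_image, Finset.mem_filter, Finset.mem_univ, true_and] at hb ⊢
      obtain ⟨c, hc, rfl⟩ := hb
      exact ⟨(hψ c (hRne c hc).1).1, hψA c hc⟩
    have hBc : B.card + 1 = n := by
      have hBeq : B = ((Finset.univ.filter fun x => ¬R p₀ x).erase W).erase p₀ := by
        ext x; simp only [hB, Finset.mem_filter, Finset.mem_erase, Finset.mem_univ]; tauto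
      have h1 := Finset.card_filter_add_card_filter_not (s := (Finset.univ : Finset P))
        (fun x => R p₀ x)
      rw [Finset.card_univ, hcardP] at h1
      have h2 := hRcard p₀ hp₀
      rw [hBeq, Finset.card_erase_of_mem (by simp [hp₀, hRirr]),
        Finset.card_erase_of_mem (by simp [hRw])]
      omega
    have hAc : (A.image ψ).card = A.card := Finset.card_image_of_injOn fun a ha b hb hab =>
      hinj a b (hRne a (by simpa [hA] using ha)).1 (hRne b (by simpa [hA] using hb)).1 hab
    have hAn : A.card + 1 = n := hRcard p₀ hp₀
    have heq : A.image ψ = B := Finset.eq_of_subset_of_card_le hsub (by omega)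
    intro b h1 h2 h3
    have hb : b ∈ A.image ψ := by rw [heq]; simp [hB, h1, h2, h3]
    simpa [hA] using hb
  have hpart := fun (x y : P) (hxy : x ≠ y) =>
    existsUnique_spokeStar_adj hp₀ hRanti hRirr hRw hψ hψR hψA hinj hsurj hxy
  -- the first centres, one for each tree
  set I : Finset P := insert p₀ (Finset.univ.filter fun x => R p₀ x) with hI
  have hIc : I.card = n := by
    rw [hI, Finset.card_insert_of_notMem (by simp [hRirr]), hRcard p₀ hp₀]
  have hImem : ∀ c, c ∈ I ↔ c = p₀ ∨ R p₀ c := fun c => by simp [hI]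
  have hIW : ∀ c ∈ I, c ≠ W := by
    intro c hc
    rcases (hImem c).1 hc with rfl | h
    exacts [hp₀, (hRne c h).1]
  set e : Fin n ≃ I := (I.equivFinOfCardEq hIc).symm with he
  set D : P → P := fun c => if c = p₀ then W else ψ c with hD
  set S : P → Set P := fun c => {x | x = W ∨ R c x} with hS
  have hDS : ∀ c ∈ I, D c ∈ S c := by
    intro c hc
    by_cases h : c = p₀
    · simp [hD, hS, h]
    · simp only [hD, hS, h, if_false]
      exact Or.inr (hψ c (hIW c hc)).2
  have hcS : ∀ c ∈ I, c ∉ S c := by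
    rintro c hc (h | h)
    exacts [hIW c hc h, hRirr c h]
  have hSn : ∀ c ∈ I, (S c).ncard = n ∧ (S c)ᶜ.ncard = n := by
    intro c hc
    have h1 : S c = ((insert W (Finset.univ.filter fun x => R c x) : Finset P) : Set P) := by
      ext x; simp [hS]
    have h2 : (S c).ncard = n := by
      rw [h1, Set.ncard_coe_finset, Finset.card_insert_of_notMem (by simp [hRw]),
        hRcard c (hIW c hc)]
    have h3 := Set.ncard_add_ncard_compl (S c)
    rw [Nat.card_eq_fintype_card, hcardP] at h3
    omega
  have hT : ∀ c, spokeStar R ψ W p₀ c = doubleStar c (D c) (S c) := fun c => by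
    by_cases h : c = p₀ <;> simp only [spokeStar, hD, hS, h, if_true, if_false]
  have hplane : ∀ c ∈ I, IsPlane (spokeStar R ψ W p₀ c) := by
    intro c hc
    rw [hT]
    refine doubleStar_isPlane hP (hDS c hc) (hcS c hc) fun x hx hxd y hy hyc => ?_
    have hy' : y ≠ W ∧ ¬R c y := by simpa [hS] using hy
    have hwy := hRneg c y (hIW c hc) hy'.1 hyc.symm hy'.2
    by_cases h : c = p₀
    · -- the line through the centres `c` and `w` separates the leaves
      have hDW : D c = W := by simp [hD, h]
      rw [hDW] at hxd ⊢
      have hRx : R c x := hx.resolve_left hxd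
      refine disjoint_segment_of_orient (Subtype.coe_ne_coe.2 (hIW c hc)) ?_ ?_ <;>
        rw [orient_swap (W : Plane) c]
      · exact neg_neg_iff_pos.2 hRx
      · exact neg_pos.2 hwy
    · have hDψ : D c = ψ c := by simp [hD, h]
      rw [hDψ] at hxd ⊢
      obtain ⟨hψW, hcψ⟩ := hψ c (hIW c hc)
      have hψc : c ≠ ψ c := fun h => hRirr c (by rwa [← h] at hcψ)
      have hyψ : y ≠ ψ c := fun h => hy'.2 (h ▸ hcψ)
      have hy1 := hψx c y (hIW c hc) hy'.1 hyc hyψ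
      by_cases hxW : x = W
      · -- the line through `w` and `ψ c` separates `c` from the leaves at `ψ c`
        rw [hxW, segment_symm]
        refine disjoint_segment_of_orient (Subtype.coe_ne_coe.2 hψW.symm) ?_ ?_
        · rw [orient_swap_right]; exact neg_neg_iff_pos.2 hcψ
        · exact (hψR c y (hIW c hc) hy'.1 hyc hyψ).2 hy'.2
      · -- the line through the centres separates the leaves
        have hRx : R c x := hx.resolve_left hxW
        have hxc : x ≠ c := fun h => hcS c hc (h ▸ hx)
        have hx1 := (hψx c x (hIW c hc) hxW hxc hxd).1
        exact disjoint_segment_of_orient (Subtype.coe_ne_coe.2 hψc)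
          (neg_of_mul_neg_left hx1 (le_of_lt hRx)) (pos_of_mul_neg_left hy1.1 hwy.le)
  refine ⟨fun i => spokeStar R ψ W p₀ (e i), fun i => ⟨?_, hplane _ (e i).2⟩, ?_,
    e.symm ⟨p₀, by simp [hI]⟩, fun i _ => ?_, fun i j _ _ => ?_⟩
  · simp only [hT]
    exact doubleStar_isTree (hDS _ (e i).2) (hcS _ (e i).2)
  · intro s
    induction s using Sym2.ind with
    | _ x y =>
    intro hs
    obtain ⟨c, ⟨hc, hadj⟩, huniq⟩ := hpart x y hs
    refine ⟨e.symm ⟨c, (hImem c).2 hc⟩, by simpa using hadj, fun i hi => ?_⟩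
    rw [Equiv.eq_symm_apply]
    exact Subtype.ext (huniq (e i) ⟨(hImem _).1 (e i).2, hi⟩)
  · obtain ⟨h1, h2⟩ := hSn _ (e i).2
    simp only [hT]
    exact doubleStar_isWCaterpillar (hDS _ (e i).2) (hcS _ (e i).2) (h1.trans h2.symm)
      (hn.trans h1.ge)
  · obtain ⟨h1, h2⟩ := hSn _ (e i).2
    obtain ⟨h3, h4⟩ := hSn _ (e j).2
    simp only [hT]
    exact doubleStar_iso (hDS _ (e i).2) (hcS _ (e i).2) (hDS _ (e j).2) (hcS _ (e j).2)
      (h1.trans h3.symm) (h2.trans h4.symm)
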